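/- Let $q\ge 3$ be an integer and $\lambda_q=2\cos(\pi/q)$. Let $\Gamma_q\le \mathrm{PSL}_2(\mathbb R)$ be the group generated by $S=\left[\begin{smallmatrix}0&1\\-1&0\end{smallmatrix}\right]$ and $T_q=\left[\begin{smallmatrix}1&\lambda_q\\0&1\end{smallmatrix}\right]$, acting by Möbius transformations on the hyperbolic plane $\mathbb H$ and on $P^1(\mathbb R)=\mathbb R\cup\{\infty\}$. Put $U=T_qS$ and $g_k=(U^kS)^{-1}$. Order $P^1(\mathbb R)$ by the usual order on $\mathbb R$ and $r<\infty$ for all real $r$. Two unit speed geodesics, on $\mathbb H$ or on $\Gamma_q\backslash\mathbb H$, are equivalent if they differ by a time shift; $[\cdot]$ denotes the class. A geodesic on $\Gamma_q\backslash\mathbb H$ is a $\Gamma_q$-orbit $\widehat\gamma=\Gamma_q.\gamma$ of a unit speed geodesic $\gamma$ on $\mathbb H$, called a lift of $\widehat\gamma$; it is periodic if for some $t_0>0$ one has $\widehat\gamma(t)=\widehat\gamma(t+t_0)$ for all $t$. Write $\gamma(\pm\infty)=\lim_{t\to\pm\infty}\gamma(t)\in P^1(\mathbb R)$. A reduced lift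 of $[\widehat\gamma]$ is a class $[\gamma]$, where $\gamma$ is a lift of a geodesic equivalent to $\widehat\gamma$ and $\gamma(+\infty)>0>\gamma(-\infty)$. An element of $\mathrm{PSL}_2(\mathbb R)$ is hyperbolic if it fixes exactly two points of $\mathbb H\cup P^1(\mathbb R)$. For hyperbolic $g$ let $w_a(g)$ and $w_r(g)$ be its attracting and repelling fixed points, and let $t_g>0$ be its displacement length, i.e. $g.\gamma=\gamma(\cdot+t_g)$ for geodesics $\gamma$ with $\gamma(+\infty)=w_a(g)$, $\gamma(-\infty)=w_r(g)$. A hyperbolic $g\in\Gamma_q$ has level $m$ if $m\ge1$ is the maximal integer with $g=h^m$ for some $h\in\Gamma_q$; it is primitive if its level is $1$. **Statement.** Let $[\widehat\gamma]$ be a class of periodic geodesics on $\Gamma_q\backslash\mathbb H$ and let $[\gamma_0]$ be one of its reduced lifts. For $i=1,2,3,\ldots$ there is a unique $k_i\in\{1,\ldots,q-1\}$ with $\gamma_{i-1}(+\infty)\in(g_{k_i}^{-1}.0,\;g_{k_i}^{-1}.\infty)$, and we set $[\gamma_i]=[g_{k_i}.\gamma_{i-1}]$. Then there is $n\ge 1$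 with $[\gamma_n]=[\gamma_0]$. For the minimal such $n$, the classes $[\gamma_0],\ldots,[\gamma_{n-1}]$ are pairwise distinct and $\{[\gamma_0],\ldots,[\gamma_{n-1}]\}$ is the set of all reduced lifts of $[\widehat\gamma]$. Moreover $$h=g_{k_1}^{-1}g_{k_2}^{-1}\cdots g_{k_n}^{-1}$$ is a primitive hyperbolic element of $\Gamma_q$ with $(w_a(h),w_r(h))=(\gamma_0(+\infty),\gamma_0(-\infty))$. For every $m\ge1$, $h^m$ is the unique hyperbolic $g\in\Gamma_q$ of level $m$ with $(w_a(g),w_r(g))=(\gamma_0(+\infty),\gamma_0(-\infty))$, and likewise the unique hyperbolic $g\in\Gamma_q$ of level $m$ with $(w_a(g),w_r(g),t_g)=(\gamma_0(+\infty),\gamma_0(-\infty),m\,t_h)$. -/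

import Mathlib

open Filter Topology
open scoped UpperHalfPlane MatrixGroups

noncomputable section

namespace HeckeReduction

/-! ### The group `G = PSL₂(ℝ)` and its actions on `ℍ` and on `P¹(ℝ) = ℝ ∪ {∞}` -/

/-- `G = PSL₂(ℝ) = SL₂(ℝ) / {± 1}`. -/
abbrev G : Type := Matrix.ProjectiveSpecialLinearGroup (Fin 2) ℝ

/-- The geodesic boundary `P¹(ℝ) = ℝ ∪ {∞}` of `ℍ`. -/
abbrev P1 : Type := OnePoint ℝ

/-- The class in `PSL₂(ℝ)` of a matrix in `SL₂(ℝ)`. -/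
def toG : SL(2, ℝ) →* G := QuotientGroup.mk' _

lemma eq_one_or_neg_one_of_mem_center {A : SL(2, ℝ)} (hA : A ∈ Subgroup.center SL(2, ℝ)) :
    A = 1 ∨ A = -1 := by
  obtain ⟨r, hr, h⟩ := Matrix.SpecialLinearGroup.mem_center_iff.1 hA
  simp only [Fintype.card_fin, sq_eq_one_iff] at hr
  rcases hr with rfl | rfl
  · left; ext i j; rw [← h]; simp [Matrix.one_apply, Matrix.diagonal_apply]
  · right; ext i j; rw [← h]
    fin_cases i <;> fin_cases j <;> simp

/-- The Möbius action of `SL₂(ℝ)` on `ℍ`, as a homomorphism to permutations, descends to `G`. -/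
def permH : G →* Equiv.Perm ℍ :=
  QuotientGroup.lift _ (MulAction.toPermHom SL(2, ℝ) ℍ) (by
    intro A hA
    rcases eq_one_or_neg_one_of_mem_center hA with rfl | rfl
    · exact map_one _
    · ext z
      simp [UpperHalfPlane.coe_specialLinearGroup_apply, neg_div_neg_eq])

/-- The Möbius action of `SL₂(ℝ)` on `P¹(ℝ)` (through `GL₂(ℝ)`) descends to `G`. -/
def permP1 : G →* Equiv.Perm P1 :=
  QuotientGroup.lift _
    ((MulAction.toPermHom (GL (Fin 2) ℝ) P1).comp (Matrix.SpecialLinearGroup.mapGL ℝ)) (by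
    intro A hA
    rcases eq_one_or_neg_one_of_mem_center hA with rfl | rfl
    · exact map_one _
    · ext x
      induction x using OnePoint.rec with
      | infty => simp [OnePoint.smul_infty_eq_ite]
      | coe x => simp [OnePoint.smul_some_eq_ite])

instance : MulAction G ℍ := MulAction.compHom ℍ permH

instance : MulAction G P1 := MulAction.compHom P1 permP1

lemma toG_smul (A : SL(2, ℝ)) (z : ℍ) : toG A • z = A • z := rfl

lemma toG_smul_P1 (A : SL(2, ℝ)) (x : P1) :
    toG A • x = (Matrix.SpecialLinearGroup.mapGL ℝ A : GL (Fin 2) ℝ) • x := rfl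

instance : IsIsometricSMul G ℍ where
  isometry_smul g := by
    obtain ⟨A, rfl⟩ := QuotientGroup.mk'_surjective _ g
    exact isometry_smul ℍ A

/-- The order on `P¹(ℝ) = ℝ ∪ {∞}`: the usual one on `ℝ`, and `r < ∞` for all real `r`. -/
def P1Lt (x y : P1) : Prop := ∃ a : ℝ, x = a ∧ ∀ b : ℝ, y = b → a < b

/-- The inclusion of `P¹(ℝ)` into the Riemann sphere `ℂ ∪ {∞}`. The topology of
`ℍ ∪ P¹(ℝ)` is the one induced from the Riemann sphere. -/
def P1.toSphere (x : P1) : OnePoint ℂ := x.map Complex.ofReal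

/-- `z` tends along the filter `l` to the boundary point `x`, in `ℍ ∪ P¹(ℝ)`. -/
def TendsToBoundary {ι : Type*} (z : ι → ℍ) (l : Filter ι) (x : P1) : Prop :=
  Tendsto (fun t => ((z t : ℂ) : OnePoint ℂ)) l (𝓝 (P1.toSphere x))

/-! ### Hyperbolic elements -/

/-- `g` is hyperbolic: it fixes exactly two points in `ℍ ∪ P¹(ℝ)`. -/
def IsHyperbolic (g : G) : Prop := {p : ℍ ⊕ P1 | g • p = p}.ncard = 2

/-- `g` is hyperbolic with attracting fixed point `x` and repelling fixed point `y`, that is,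
`x = w_a(g)` and `y = w_r(g)`. -/
def HasFixedPair (g : G) (x y : P1) : Prop :=
  IsHyperbolic g ∧ g • x = x ∧ g • y = y ∧
    ∀ z : ℍ, TendsToBoundary (fun n : ℕ => g ^ n • z) atTop x ∧
      TendsToBoundary (fun n : ℕ => g⁻¹ ^ n • z) atTop y

/-! ### Geodesics on `ℍ` -/

/-- Complete unit speed geodesics on `ℍ` (for the hyperbolic metric, which is the metric that
Mathlib puts on `ℍ`). -/
@[ext] structure UGeo where
  toFun : ℝ → ℍ
  isometry : Isometry toFun

instance : CoeFun UGeo (fun _ => ℝ → ℍ) := ⟨UGeo.toFun⟩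

instance : MulAction G UGeo where
  smul g γ := ⟨fun t => g • γ t, (isometry_smul ℍ g).comp γ.isometry⟩
  one_smul γ := UGeo.ext (funext fun t => one_smul G (γ t))
  mul_smul g h γ := UGeo.ext (funext fun t => mul_smul g h (γ t))

lemma UGeo.smul_apply (g : G) (γ : UGeo) (t : ℝ) : (g • γ) t = g • γ t := rfl

/-- Equivalence of geodesics on `ℍ`: `η = γ(· + s)` for some real `s`. -/
instance UGeo.setoid : Setoid UGeo where
  r γ η := ∃ s : ℝ, ∀ t, η t = γ (t + s)
  iseqv :=
    { refl := fun γ => ⟨0, fun t => by simp⟩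
      symm := fun ⟨s, h⟩ => ⟨-s, fun t => by simp [h]⟩
      trans := fun ⟨s, h⟩ ⟨s', h'⟩ => ⟨s' + s, fun t => by rw [h', h, add_assoc]⟩ }

/-- The set of classes `[γ]` of geodesics on `ℍ` up to reparametrization. -/
def GeoClass : Type := Quotient UGeo.setoid

/-- The class `[γ]`. -/
def GeoClass.mk (γ : UGeo) : GeoClass := Quotient.mk _ γ

/-- `g.[γ] = [g.γ]`. -/
instance : SMul G GeoClass where
  smul g := Quotient.map (fun γ => g • γ) (by
    rintro γ η ⟨s, h⟩
    exact ⟨s, fun t => by rw [UGeo.smul_apply, UGeo.smul_apply, h]⟩)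

lemma GeoClass.smul_mk (g : G) (γ : UGeo) : g • GeoClass.mk γ = GeoClass.mk (g • γ) := rfl

/-- `γ(+∞) = x` and `γ(-∞) = y`. -/
def UGeo.HasEnds (γ : UGeo) (x y : P1) : Prop :=
  TendsToBoundary γ atTop x ∧ TendsToBoundary γ atBot y

/-- `[γ](+∞) = x` and `[γ](-∞) = y`, where the endpoints of `[γ]` are those of `γ`. -/
def GeoClass.HasEnds (c : GeoClass) (x y : P1) : Prop :=
  ∃ γ : UGeo, GeoClass.mk γ = c ∧ γ.HasEnds x y

/-- `γ` is reduced: `γ(+∞) > 0 > γ(-∞)`. -/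
def UGeo.IsReduced (γ : UGeo) : Prop :=
  ∃ x y : P1, γ.HasEnds x y ∧ P1Lt (0 : ℝ) x ∧ P1Lt y (0 : ℝ)

/-- `t` is the displacement length of the hyperbolic element `g`: `t > 0` and
`g.γ = γ(· + t)` for a geodesic `γ` that runs from the repelling to the attracting
fixed point of `g`. -/
def HasDisplacement (g : G) (t : ℝ) : Prop :=
  0 < t ∧ ∃ (γ : UGeo) (x y : P1), HasFixedPair g x y ∧ γ.HasEnds x y ∧
    ∀ s, (g • γ) s = γ (s + t)

/-! ### Hecke triangle groups -/

/-- The matrix `(0, 1; -1, 0)`. -/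
def matS : SL(2, ℝ) := ⟨!![0, 1; -1, 0], by simp [Matrix.det_fin_two]⟩

/-- The matrix `(1, λ_q; 0, 1)` with `λ_q = 2 cos (π / q)`. -/
def matT (q : ℕ) : SL(2, ℝ) :=
  ⟨!![1, 2 * Real.cos (Real.pi / q); 0, 1], by simp [Matrix.det_fin_two]⟩

/-- `S = [0, 1; -1, 0]`. -/
def S : G := toG matS

/-- `T_q = [1, λ_q; 0, 1]` with `λ_q = 2 cos (π / q)`. -/
def T (q : ℕ) : G := toG (matT q)

/-- The Hecke triangle group `Γ_q`, generated by `S` and `T_q`. -/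
def Gam (q : ℕ) : Subgroup G := Subgroup.closure {S, T q}

/-- `g_k = (U ^ k * S)⁻¹` with `U = T_q * S`. -/
def gk (q k : ℕ) : G := ((T q * S) ^ k * S)⁻¹

/-- `Γ_{h,n}`, the hyperbolic elements `g` of `Γ_q` of level `n`: `n` is the maximal positive
integer for which `g` is an `n`-th power in `Γ_q`. -/
def GamLevel (q n : ℕ) : Set G :=
  {g | g ∈ Gam q ∧ IsHyperbolic g ∧ IsGreatest {m : ℕ | 1 ≤ m ∧ ∃ h ∈ Gam q, g = h ^ m} n}

/-- `g` is a primitive hyperbolic element of `Γ_q`: it has level `1`. -/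
def IsPrimitiveHyperbolic (q : ℕ) (g : G) : Prop := g ∈ GamLevel q 1

/-! ### Geodesics on `X_q = Γ_q \ ℍ` -/

/-- The orbit space `X_q = Γ_q \ ℍ`. -/
def X (q : ℕ) : Type := MulAction.orbitRel.Quotient (Gam q) ℍ

/-- The geodesics on `X_q`: the `Γ_q`-orbits of geodesics on `ℍ`. -/
def GeoX (q : ℕ) : Type := MulAction.orbitRel.Quotient (Gam q) UGeo

/-- The projection `γ ↦ Γ_q.γ`. -/
def GeoX.proj (q : ℕ) (γ : UGeo) : GeoX q := Quotient.mk _ γ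

/-- The geodesic `Γ_q.γ` as the map `t ↦ Γ_q.γ(t)` from `ℝ` to `X_q`. -/
def GeoX.eval {q : ℕ} (γh : GeoX q) (t : ℝ) : X q :=
  Quotient.liftOn γh (fun γ => (Quotient.mk _ (γ t) : X q)) (by
    rintro γ η ⟨g, rfl⟩
    exact Quotient.sound ⟨g, rfl⟩)

/-- `γh` is periodic: `γh(t) = γh(t + t₀)` for all `t`, for some `t₀ > 0`. -/
def GeoX.IsPeriodic {q : ℕ} (γh : GeoX q) : Prop :=
  ∃ t₀ : ℝ, 0 < t₀ ∧ ∀ t, γh.eval t = γh.eval (t + t₀)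

/-- The set of periodic geodesics on `X_q`. -/
structure PGeo (q : ℕ) where
  geo : GeoX q
  periodic : geo.IsPeriodic

/-- Equivalence of periodic geodesics on `X_q`: they coincide up to a reparametrization. -/
instance PGeo.setoid (q : ℕ) : Setoid (PGeo q) where
  r a b := ∃ s : ℝ, ∀ t, b.geo.eval t = a.geo.eval (t + s)
  iseqv :=
    { refl := fun a => ⟨0, fun t => by simp⟩
      symm := fun ⟨s, h⟩ => ⟨-s, fun t => by simp [h]⟩
      trans := fun ⟨s, h⟩ ⟨s', h'⟩ => ⟨s' + s, fun t => by rw [h', h, add_assoc]⟩ }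

/-- The classes of periodic geodesics on `X_q` up to reparametrization. -/
def PGeoClass (q : ℕ) : Type := Quotient (PGeo.setoid q)

/-- `c` is a reduced lift of the class `ch`: `c = [γ]` where `γ` is reduced and is a lift of a
periodic geodesic `γh` of class `ch`. -/
def IsReducedLift {q : ℕ} (ch : PGeoClass q) (c : GeoClass) : Prop :=
  ∃ (γ : UGeo) (γh : PGeo q), GeoClass.mk γ = c ∧ (Quotient.mk _ γh : PGeoClass q) = ch ∧
    GeoX.proj q γ = γh.geo ∧ γ.IsReduced

/-- `k ∈ {1, …, q - 1}` and `c(+∞)` lies in the interval `(g_k⁻¹.0, g_k⁻¹.∞)`. -/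
def IsIntervalIndex (q : ℕ) (c : GeoClass) (k : ℕ) : Prop :=
  1 ≤ k ∧ k ≤ q - 1 ∧ ∃ x y : P1, c.HasEnds x y ∧
    P1Lt ((gk q k)⁻¹ • ((0 : ℝ) : P1)) x ∧ P1Lt x ((gk q k)⁻¹ • (OnePoint.infty : P1))

/-- The product `g_{k 1}⁻¹ * ⋯ * g_{k n}⁻¹`, in this order. -/
def periodProd (q : ℕ) (k : ℕ → ℕ) (n : ℕ) : G :=
  ((List.range n).map fun i => (gk q (k (i + 1)))⁻¹).prod

end HeckeReduction

end

noncomputable section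

namespace HeckeReduction

/-! ### Boundary limits -/

/-! Write `U = T q * S`. For `1 ≤ k ≤ q - 1` the element `(gk q k)⁻¹ = U ^ k * S` has a matrix
representative whose entries dominate those of the identity, with positive off-diagonal sum
(`gk_inv_matrix`). Words in these letters therefore preserve the positive part of the boundary,
their inverses preserve the negative part, and a nonempty word is never trivial. Since `S ^ 2 = U ^
q = 1`, every element of the Hecke group is a word, up to a factor `S` at either end
(`isWordForm_of_mem`). If such an element takes a reduced class to a reduced class, the signs of the
endpoints leave only words and inverses of words (`exists_wordProd_of_isReduced`). The intervals
`(g_k⁻¹.0, g_k⁻¹.∞)` are the images `g_k⁻¹.(0, ∞)`. They are disjoint and miss only translates of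
`∞` in `(0, ∞)`. A closed geodesic avoids these translates, so the reduction map `step` is well
defined along its orbit. If `w` is a word and `w⁻¹.c` is reduced, the letters of `w` must be the
successive interval indices of `c`; hence `w⁻¹.c` is an iterate of `step`
(`wordProd_inv_smul_eq_iterate_step`). Periodicity supplies a nontrivial element of the stabilizer,
hence a return to `c`. All reduced lifts lie on this cycle, and the product `h` over the minimal
period generates the stabilizer. Words translate a reduced axis forwards, so comparing translation
lengths in the cyclic group generated by `h` shows that `h ^ m` has level `m` and is the only such
element with the given endpoints. -/

lemma tendsToBoundary_coe {ι : Type*} {z : ι → ℍ} {l : Filter ι} {x : ℝ} :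
    TendsToBoundary z l (x : P1) ↔ Tendsto (fun t => (z t : ℂ)) l (𝓝 (x : ℂ)) := by
  have : P1.toSphere (x : P1) = ((x : ℂ) : OnePoint ℂ) := rfl
  rw [TendsToBoundary, this]
  exact (OnePoint.isOpenEmbedding_coe.tendsto_nhds_iff (f := fun t => (z t : ℂ))).symm

lemma tendsToBoundary_infty {ι : Type*} {z : ι → ℍ} {l : Filter ι} :
    TendsToBoundary z l OnePoint.infty ↔
      Tendsto (fun t => (z t : ℂ)) l (Bornology.cobounded ℂ) := by
  have : P1.toSphere OnePoint.infty = (OnePoint.infty : OnePoint ℂ) := rfl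
  rw [TendsToBoundary, this, Metric.cobounded_eq_cocompact, ← coclosedCompact_eq_cocompact,
    ← OnePoint.comap_coe_nhds_infty, tendsto_comap_iff]
  rfl

lemma toSphere_injective : Function.Injective P1.toSphere :=
  Option.map_injective Complex.ofReal_injective

lemma TendsToBoundary.unique {ι : Type*} {z : ι → ℍ} {l : Filter ι} [l.NeBot] {x y : P1}
    (hx : TendsToBoundary z l x) (hy : TendsToBoundary z l y) : x = y :=
  toSphere_injective (tendsto_nhds_unique hx hy)

lemma toG_surjective : Function.Surjective toG := QuotientGroup.mk'_surjective _

lemma toG_smul_coe (A : SL(2, ℝ)) (x : ℝ) : toG A • (x : P1) =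
    if A 1 0 * x + A 1 1 = 0 then OnePoint.infty
    else (((A 0 0 * x + A 0 1) / (A 1 0 * x + A 1 1) : ℝ) : P1) := by
  rw [toG_smul_P1, OnePoint.smul_some_eq_ite]; simp

lemma toG_smul_infty (A : SL(2, ℝ)) : toG A • (OnePoint.infty : P1) =
    if A 1 0 = 0 then OnePoint.infty else ((A 0 0 / A 1 0 : ℝ) : P1) := by
  rw [toG_smul_P1, OnePoint.smul_infty_eq_ite]; simp

lemma coe_toG_smul (A : SL(2, ℝ)) (z : ℍ) : ((toG A • z : ℍ) : ℂ) =
    ((A 0 0 : ℂ) * z + A 0 1) / ((A 1 0 : ℂ) * z + A 1 1) := by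
  rw [toG_smul, UpperHalfPlane.coe_specialLinearGroup_apply]; simp

lemma det_eq_one (A : SL(2, ℝ)) : A 0 0 * A 1 1 - A 0 1 * A 1 0 = 1 := by
  rw [← Matrix.det_fin_two, A.det_coe]

lemma denom_ne_zero (A : SL(2, ℝ)) (z : ℍ) : (A 1 0 : ℂ) * z + A 1 1 ≠ 0 := by
  intro h
  have him := congrArg Complex.im h
  have hre := congrArg Complex.re h
  simp [z.im_pos.ne'] at him hre
  have := det_eq_one A
  simp [him] at hre
  simp [him, hre] at this

/-- In this form `w` occurs only once, so limits at finite points, at the pole and at infinity all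
reduce to the behaviour of inversion. -/
lemma moebius_eq_sub_inv {K : Type*} [Field K] {a b c d w : K} (hdet : a * d - b * c = 1)
    (hc : c ≠ 0) (hw : c * w + d ≠ 0) : (a * w + b) / (c * w + d) = a / c - c⁻¹ * (c * w + d)⁻¹ := by
  obtain ⟨u, hu⟩ : ∃ u, u = c * w + d := ⟨_, rfl⟩
  rw [← hu] at hw ⊢
  field_simp
  linear_combination (-a) * hu - hdet

lemma TendsToBoundary.smul {ι : Type*} {z : ι → ℍ} {l : Filter ι} {x : P1}
    (hx : TendsToBoundary z l x) (g : G) : TendsToBoundary (fun t => g • z t) l (g • x) := by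
  obtain ⟨A, rfl⟩ := toG_surjective g
  have hdet := det_eq_one A
  by_cases hc : A 1 0 = 0
  · have hd : A 1 1 ≠ 0 := by rintro h; simp [hc, h] at hdet
    have ha : A 0 0 ≠ 0 := by rintro h; simp [hc, h] at hdet
    induction x using OnePoint.rec with
    | infty =>
      rw [toG_smul_infty, if_pos hc, tendsToBoundary_infty]
      rw [tendsToBoundary_infty] at hx
      simp only [coe_toG_smul, hc, Complex.ofReal_zero, zero_mul, zero_add]
      have h1 : Tendsto (fun w : ℂ => (A 0 0 : ℂ) * w) (Bornology.cobounded ℂ)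
          (Bornology.cobounded ℂ) := by
        exact tendsto_mul_left_cobounded (by exact_mod_cast ha)
      have h2 : Tendsto (fun w : ℂ => w + (A 0 1 : ℂ)) (Bornology.cobounded ℂ)
          (Bornology.cobounded ℂ) := by
        exact tendsto_add_const_cobounded _
      have h3 : Tendsto (fun w : ℂ => w / (A 1 1 : ℂ)) (Bornology.cobounded ℂ)
          (Bornology.cobounded ℂ) := by
        simp only [div_eq_mul_inv]
        exact tendsto_mul_right_cobounded (by simpa using hd)
      exact h3.comp (h2.comp (h1.comp hx))
    | coe x =>
      rw [tendsToBoundary_coe] at hx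
      rw [toG_smul_coe, if_neg (by simpa [hc] using hd), tendsToBoundary_coe]
      simp only [coe_toG_smul, hc, Complex.ofReal_zero, zero_mul, zero_add]
      push_cast
      exact ((hx.const_mul _).add_const _).div_const _
  · have hc' : (A 1 0 : ℂ) ≠ 0 := by exact_mod_cast hc
    have key : ∀ t, ((toG A • z t : ℍ) : ℂ) =
        A 0 0 / A 1 0 - (A 1 0 : ℂ)⁻¹ * ((A 1 0 : ℂ) * z t + A 1 1)⁻¹ := by
      intro t
      have hdet' : (A 0 0 : ℂ) * A 1 1 - A 0 1 * A 1 0 = 1 := by exact_mod_cast hdet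
      rw [coe_toG_smul]
      have := denom_ne_zero A (z t)
      exact moebius_eq_sub_inv hdet' hc' this
    have hlim : ∀ w : ℂ, Tendsto (fun t => ((A 1 0 : ℂ) * z t + A 1 1)⁻¹) l (𝓝 w) →
        Tendsto (fun t => ((toG A • z t : ℍ) : ℂ)) l (𝓝 (A 0 0 / A 1 0 - (A 1 0 : ℂ)⁻¹ * w)) := by
      intro w hw
      simp only [key]
      exact (hw.const_mul _).const_sub _
    induction x using OnePoint.rec with
    | infty =>
      rw [toG_smul_infty, if_neg hc, tendsToBoundary_coe]
      rw [tendsToBoundary_infty] at hx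
      have h := hlim 0 (tendsto_inv₀_cobounded.comp ((tendsto_add_const_cobounded (A 1 1 : ℂ)).comp
        ((tendsto_mul_left_cobounded hc').comp hx)))
      simpa using h
    | coe x =>
      rw [tendsToBoundary_coe] at hx
      have hden := (hx.const_mul (A 1 0 : ℂ)).add_const (A 1 1 : ℂ)
      by_cases h0 : A 1 0 * x + A 1 1 = 0
      · rw [toG_smul_coe, if_pos h0, tendsToBoundary_infty]
        simp only [key]
        have h0' : (A 1 0 : ℂ) * x + A 1 1 = 0 := by exact_mod_cast h0
        rw [h0'] at hden
        -- The denominator has no zero on `ℍ`, so it approaches `0` through nonzero values and its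
        -- inverse tends to infinity.
        have h1 : Tendsto (fun t => (A 1 0 : ℂ) * z t + A 1 1) l (𝓝[≠] 0) :=
          tendsto_nhdsWithin_iff.2 ⟨hden, Eventually.of_forall fun t => denom_ne_zero A (z t)⟩
        exact (tendsto_const_sub_cobounded _).comp
          ((tendsto_mul_left_cobounded (inv_ne_zero hc')).comp (tendsto_inv₀_nhdsNE_zero.comp h1))
      · rw [toG_smul_coe, if_neg h0, tendsToBoundary_coe]
        have h0' : (A 1 0 : ℂ) * x + A 1 1 ≠ 0 := by exact_mod_cast h0
        convert hlim _ (hden.inv₀ h0') using 2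
        have hdet' : (A 0 0 : ℂ) * A 1 1 - A 0 1 * A 1 0 = 1 := by exact_mod_cast hdet
        push_cast
        exact moebius_eq_sub_inv hdet' hc' h0'

/-! ### Geodesics -/

lemma toG_neg (A : SL(2, ℝ)) : toG (-A) = toG A := by
  refine QuotientGroup.eq.2 ?_
  rw [Matrix.SpecialLinearGroup.mem_center_iff]
  refine ⟨-1, by simp, ?_⟩
  have : (-A)⁻¹ * A = -1 := by
    rw [inv_mul_eq_iff_eq_mul]; simp
  rw [this]
  ext i j; fin_cases i <;> fin_cases j <;> simp

/-- The standard geodesic `t ↦ i e ^ t`. -/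
def stdGeo : UGeo := ⟨fun t => .mk ⟨0, Real.exp t⟩ (Real.exp_pos t),
  UpperHalfPlane.isometry_vertical_line 0⟩

lemma coe_stdGeo (t : ℝ) : ((stdGeo t : ℍ) : ℂ) = Real.exp t * Complex.I := by
  apply Complex.ext <;> simp [stdGeo, -Complex.ofReal_exp]

lemma stdGeo_re (t : ℝ) : (stdGeo t).re = 0 := rfl

lemma stdGeo_im (t : ℝ) : (stdGeo t).im = Real.exp t := rfl

lemma stdGeo_zero : stdGeo 0 = UpperHalfPlane.I := by
  apply UpperHalfPlane.ext; rw [coe_stdGeo]; simp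

lemma stdGeo_hasEnds : stdGeo.HasEnds OnePoint.infty ((0 : ℝ) : P1) := by
  constructor
  · rw [tendsToBoundary_infty, ← tendsto_norm_atTop_iff_cobounded]
    simp only [coe_stdGeo, norm_mul, Complex.norm_I, mul_one, Complex.norm_real, Real.norm_eq_abs,
      Real.abs_exp]
    exact Real.tendsto_exp_atTop
  · rw [tendsToBoundary_coe]
    simp only [coe_stdGeo]
    have h : Tendsto (fun t => ((Real.exp t : ℝ) : ℂ) * Complex.I) atBot
        (𝓝 (((0 : ℝ) : ℂ) * Complex.I)) :=
      ((Complex.continuous_ofReal.tendsto _).comp Real.tendsto_exp_atBot).mul_const _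
    simpa using h

lemma sq_add_sq_of_dist_stdGeo {z : ℍ} {r t : ℝ} (h : dist z (stdGeo r) = |t - r|) :
    z.re ^ 2 + z.im ^ 2 + Real.exp r ^ 2 =
      z.im * (Real.exp t + Real.exp r ^ 2 * Real.exp (-t)) := by
  have h1 := UpperHalfPlane.cosh_dist' z (stdGeo r)
  rw [h, Real.cosh_abs, stdGeo_re, stdGeo_im, Real.cosh_eq, neg_sub, Real.exp_sub, Real.exp_sub,
    sub_zero] at h1
  have := z.im_pos
  rw [Real.exp_neg]
  field_simp at h1 ⊢
  linear_combination -h1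

/-- The two distance equations share the term `re ^ 2 + im ^ 2`. Subtracting them leaves `im = e ^
t`, and substituting back gives `re = 0`. -/
lemma eq_stdGeo_of_dist {z : ℍ} {r s t : ℝ} (hrs : r ≠ s) (hr : dist z (stdGeo r) = |t - r|)
    (hs : dist z (stdGeo s) = |t - s|) : z = stdGeo t := by
  have h1 := sq_add_sq_of_dist_stdGeo hr
  have h2 := sq_add_sq_of_dist_stdGeo hs
  have hne : Real.exp r ^ 2 - Real.exp s ^ 2 ≠ 0 := by
    rw [sub_ne_zero, Ne, sq_eq_sq₀ (Real.exp_pos r).le (Real.exp_pos s).le, Real.exp_eq_exp]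
    exact hrs
  have him : z.im * Real.exp (-t) = 1 := by
    apply mul_left_cancel₀ hne
    linear_combination h2 - h1
  have him' : z.im = Real.exp t := by
    rw [Real.exp_neg] at him
    field_simp at him
    exact him
  have hre : z.re = 0 := by
    rw [← sq_eq_zero_iff]
    rw [him'] at h1 him
    linear_combination h1 + Real.exp r ^ 2 * him
  apply UpperHalfPlane.ext
  apply Complex.ext
  · exact hre
  · exact him'

lemma exists_smul_re_eq_zero (w : ℍ) :
    ∃ g : G, g • UpperHalfPlane.I = UpperHalfPlane.I ∧ (g • w).re = 0 := by
  -- Rotating about `i` by the matrix with angle `φ` puts `w` on the imaginary axis exactly when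
  -- `cos 2φ * re w = sin 2φ * (|w|² - 1) / 2`, so `2φ` is taken to be the argument of this `ζ`.
  set ζ : ℂ := ⟨(w.re ^ 2 + w.im ^ 2 - 1) / 2, w.re⟩ with hζ
  set φ : ℝ := ζ.arg / 2 with hφ
  have hcs := Real.sin_sq_add_cos_sq φ
  let A : SL(2, ℝ) := ⟨!![Real.cos φ, Real.sin φ; -Real.sin φ, Real.cos φ], by
    rw [Matrix.det_fin_two_of]; linear_combination hcs⟩
  refine ⟨toG A, ?_, ?_⟩
  · apply UpperHalfPlane.ext
    rw [coe_toG_smul, div_eq_iff (denom_ne_zero A _)]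
    simp only [UpperHalfPlane.coe_I]
    simp [A]
    linear_combination (Complex.sin φ) * Complex.I_mul_I
  · have h1 : Real.cos (2 * φ) * w.re = Real.sin (2 * φ) * ((w.re ^ 2 + w.im ^ 2 - 1) / 2) := by
      have h2 : 2 * φ = ζ.arg := by rw [hφ]; ring
      have hc := Complex.norm_mul_cos_arg ζ
      have hs := Complex.norm_mul_sin_arg ζ
      by_cases h0 : ζ = 0
      · have e1 : w.re = 0 := congrArg Complex.im h0
        have e2 : (w.re ^ 2 + w.im ^ 2 - 1) / 2 = 0 := congrArg Complex.re h0
        rw [e2, e1]; simp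
      · apply mul_left_cancel₀ (norm_ne_zero_iff.2 h0)
        rw [h2]
        change _ = ζ.re at hc
        change _ = ζ.im at hs
        have e1 : ζ.re = (w.re ^ 2 + w.im ^ 2 - 1) / 2 := rfl
        have e2 : ζ.im = w.re := rfl
        rw [← e1, ← e2, ← mul_assoc, ← mul_assoc, hc, hs, mul_comm]
    rw [Real.cos_two_mul', Real.sin_two_mul] at h1
    have h3 : ((toG A • w : ℍ) : ℂ).re = 0 := by
      rw [coe_toG_smul, Complex.div_re, ← add_div]
      apply div_eq_zero_iff.2; left
      simp [A, -Complex.ofReal_cos, -Complex.ofReal_sin]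
      linear_combination h1
    exact h3

lemma eq_stdGeo_of_re_eq_zero {z : ℍ} (h : z.re = 0) : z = stdGeo (Real.log z.im) := by
  apply UpperHalfPlane.ext
  apply Complex.ext
  · exact h
  · exact (Real.exp_log z.im_pos).symm

lemma S_smul_stdGeo (t : ℝ) : S • stdGeo t = stdGeo (-t) := by
  apply UpperHalfPlane.ext
  rw [S, coe_toG_smul, div_eq_iff (denom_ne_zero _ _), coe_stdGeo, coe_stdGeo, Real.exp_neg]
  simp [matS]
  field_simp
  simp

lemma UGeo.dist_eq (γ : UGeo) (s t : ℝ) : dist (γ s) (γ t) = |s - t| := γ.isometry.dist_eq s t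

lemma UGeo.eq_smul_stdGeo_of_eq {γ : UGeo} {g : G} {r s : ℝ} (hrs : r ≠ s)
    (hr : γ r = g • stdGeo r) (hs : γ s = g • stdGeo s) : γ = g • stdGeo := by
  ext t : 2
  change γ t = g • stdGeo t
  rw [← inv_smul_eq_iff]
  apply eq_stdGeo_of_dist hrs
  · rw [← dist_smul g, smul_inv_smul, ← hr, γ.dist_eq]
  · rw [← dist_smul g, smul_inv_smul, ← hs, γ.dist_eq]

/-- Move `γ 0` to `i` and rotate `γ 1` onto the imaginary axis, where it must be `stdGeo 1` or
`stdGeo (-1)`; in the second case `S` reverses the axis. Two points determine the geodesic, so every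
question about geodesics reduces to `stdGeo`. -/
lemma UGeo.exists_eq_smul_stdGeo (γ : UGeo) : ∃ g : G, γ = g • stdGeo := by
  obtain ⟨A, hA⟩ := MulAction.exists_smul_eq SL(2, ℝ) (γ 0) UpperHalfPlane.I
  obtain ⟨g, hgI, hgw⟩ := exists_smul_re_eq_zero (A • γ 1)
  have h0 : (g * toG A) • γ 0 = stdGeo 0 := by
    rw [mul_smul, toG_smul, hA, hgI, stdGeo_zero]
  have h1 : (g * toG A) • γ 1 = stdGeo (Real.log (g • A • γ 1).im) := by
    rw [mul_smul, toG_smul]; exact eq_stdGeo_of_re_eq_zero hgw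
  generalize Real.log (g • A • γ 1).im = u at h1
  have hu : |0 - 1| = |0 - u| := by
    rw [← γ.dist_eq, ← stdGeo.dist_eq, ← h0, ← h1, dist_smul]
  have hu' : u = 1 ∨ u = -1 := by
    simp at hu
    exact eq_or_eq_neg_of_abs_eq hu.symm
  rcases hu' with rfl | rfl
  · exact ⟨(g * toG A)⁻¹, UGeo.eq_smul_stdGeo_of_eq zero_ne_one (eq_inv_smul_iff.2 h0)
      (eq_inv_smul_iff.2 h1)⟩
  · refine ⟨(S * (g * toG A))⁻¹, UGeo.eq_smul_stdGeo_of_eq zero_ne_one (eq_inv_smul_iff.2 ?_)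
      (eq_inv_smul_iff.2 ?_)⟩
    · rw [mul_smul, h0, S_smul_stdGeo, neg_zero]
    · rw [mul_smul, h1, S_smul_stdGeo, neg_neg]

lemma UGeo.eq_of_eq_of_eq {γ η : UGeo} {r s : ℝ} (hrs : r ≠ s) (hr : γ r = η r) (hs : γ s = η s) :
    γ = η := by
  obtain ⟨g, rfl⟩ := η.exists_eq_smul_stdGeo
  exact UGeo.eq_smul_stdGeo_of_eq hrs hr hs

/-- The time shift of a geodesic. -/
def UGeo.shift (γ : UGeo) (s : ℝ) : UGeo :=
  ⟨fun t => γ (t + s), γ.isometry.comp (isometry_add_right s)⟩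

lemma UGeo.shift_zero (γ : UGeo) : γ.shift 0 = γ := by
  ext t : 2; simp [UGeo.shift]

lemma UGeo.smul_shift (g : G) (γ : UGeo) (s : ℝ) : g • γ.shift s = (g • γ).shift s := rfl

lemma UGeo.shift_shift (γ : UGeo) (r s : ℝ) : (γ.shift r).shift s = γ.shift (r + s) := by
  ext t : 2; simp [UGeo.shift]; ring_nf

lemma mk_eq_mk_iff {γ η : UGeo} : GeoClass.mk γ = GeoClass.mk η ↔ ∃ s, η = γ.shift s := by
  rw [GeoClass.mk, GeoClass.mk]
  refine Quotient.eq.trans (exists_congr fun s => ?_)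
  rw [UGeo.ext_iff, funext_iff]; rfl

lemma UGeo.HasEnds.shift {γ : UGeo} {x y : P1} (h : γ.HasEnds x y) (s : ℝ) :
    (γ.shift s).HasEnds x y :=
  ⟨Tendsto.comp (f := fun t : ℝ => t + s) h.1 (tendsto_atTop_add_const_right _ s tendsto_id),
    Tendsto.comp (f := fun t : ℝ => t + s) h.2 (tendsto_atBot_add_const_right _ s tendsto_id)⟩

lemma UGeo.HasEnds.smul {γ : UGeo} {x y : P1} (h : γ.HasEnds x y) (g : G) :
    (g • γ).HasEnds (g • x) (g • y) :=
  ⟨TendsToBoundary.smul h.1 g, TendsToBoundary.smul h.2 g⟩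

lemma UGeo.HasEnds.unique {γ : UGeo} {x y x' y' : P1} (h : γ.HasEnds x y)
    (h' : γ.HasEnds x' y') : x = x' ∧ y = y' :=
  ⟨TendsToBoundary.unique h.1 h'.1, TendsToBoundary.unique h.2 h'.2⟩

lemma GeoClass.hasEnds_mk {γ : UGeo} {x y : P1} :
    (GeoClass.mk γ).HasEnds x y ↔ γ.HasEnds x y := by
  constructor
  · rintro ⟨η, h, hη⟩
    obtain ⟨s, rfl⟩ := mk_eq_mk_iff.1 h
    exact hη.shift s
  · exact fun h => ⟨γ, rfl, h⟩

instance : MulAction G GeoClass where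
  one_smul c := by
    obtain ⟨γ, rfl⟩ := Quotient.exists_rep c
    exact congrArg GeoClass.mk (one_smul G γ)
  mul_smul g h c := by
    obtain ⟨γ, rfl⟩ := Quotient.exists_rep c
    exact congrArg GeoClass.mk (mul_smul g h γ)

lemma GeoClass.exists_mk (c : GeoClass) : ∃ γ, GeoClass.mk γ = c := Quotient.exists_rep c

lemma GeoClass.HasEnds.smul {c : GeoClass} {x y : P1} (h : c.HasEnds x y) (g : G) :
    (g • c).HasEnds (g • x) (g • y) := by
  obtain ⟨γ, rfl, h⟩ := h
  exact ⟨g • γ, rfl, h.smul g⟩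

lemma GeoClass.HasEnds.unique {c : GeoClass} {x y x' y' : P1} (h : c.HasEnds x y)
    (h' : c.HasEnds x' y') : x = x' ∧ y = y' := by
  obtain ⟨γ, rfl⟩ := c.exists_mk
  rw [GeoClass.hasEnds_mk] at h h'
  exact h.unique h'

/-- The diagonal matrix acting by `z ↦ e ^ s z`. -/
def matD (s : ℝ) : SL(2, ℝ) := ⟨!![Real.exp (s / 2), 0; 0, Real.exp (-(s / 2))], by
  rw [Matrix.det_fin_two_of, ← Real.exp_add]; simp⟩

lemma coe_matD (s : ℝ) :
    (matD s : Matrix (Fin 2) (Fin 2) ℝ) = !![Real.exp (s / 2), 0; 0, Real.exp (-(s / 2))] := rfl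

/-- The class of the diagonal matrix acting by `z ↦ e ^ s z`. -/
def diagG (s : ℝ) : G := toG (matD s)

lemma coe_diagG_smul (s : ℝ) (z : ℍ) : ((diagG s • z : ℍ) : ℂ) = Real.exp s * z := by
  have h : Real.exp s = Real.exp (s / 2) / Real.exp (-(s / 2)) := by
    rw [← Real.exp_sub]; ring_nf
  rw [diagG, coe_toG_smul, h]
  simp [coe_matD]
  ring

lemma diagG_smul_coe (s x : ℝ) : diagG s • (x : P1) = ((Real.exp s * x : ℝ) : P1) := by
  have h : Real.exp s = Real.exp (s / 2) / Real.exp (-(s / 2)) := by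
    rw [← Real.exp_sub]; ring_nf
  rw [diagG, toG_smul_coe, if_neg (by simp [coe_matD]), h]
  congr 1
  simp [coe_matD]
  ring

lemma diagG_smul_infty (s : ℝ) : diagG s • (OnePoint.infty : P1) = OnePoint.infty := by
  rw [diagG, toG_smul_infty, if_pos (by simp [coe_matD])]

lemma diagG_smul_stdGeo (s : ℝ) : diagG s • stdGeo = stdGeo.shift s := by
  ext t : 2
  apply UpperHalfPlane.ext
  change ((diagG s • stdGeo t : ℍ) : ℂ) = ((stdGeo (t + s) : ℍ) : ℂ)
  rw [coe_diagG_smul, coe_stdGeo, coe_stdGeo, Real.exp_add]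
  push_cast; ring

lemma exists_eq_diagG {g : G} (h : g • (OnePoint.infty : P1) = OnePoint.infty)
    (h0 : g • ((0 : ℝ) : P1) = ((0 : ℝ) : P1)) : ∃ s, g = diagG s := by
  obtain ⟨A, rfl⟩ := toG_surjective g
  have hdet := det_eq_one A
  have hc : A 1 0 = 0 := by
    by_contra hc
    rw [toG_smul_infty, if_neg hc] at h
    exact OnePoint.coe_ne_infty _ h
  have hb : A 0 1 = 0 := by
    rw [toG_smul_coe] at h0
    split_ifs at h0 with hd
    · simp [hc] at hd; simp [hc, hd] at hdet
    · rw [OnePoint.coe_eq_coe, div_eq_iff hd] at h0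
      simpa using h0
  rw [hc, mul_zero, sub_zero] at hdet
  have ha : A 0 0 ≠ 0 := left_ne_zero_of_mul_eq_one hdet
  -- As `d = a⁻¹`, the scaling factor is `a / d = a²`. The sign of `a` is lost in `PSL₂`, whence the
  -- absolute value.
  refine ⟨2 * Real.log |A 0 0|, ?_⟩
  have hd : A 1 1 = (A 0 0)⁻¹ := eq_inv_of_mul_eq_one_right hdet
  rcases lt_or_gt_of_ne ha with hlt | hgt
  · rw [← toG_neg, diagG]
    congr 1
    ext i j
    fin_cases i <;> fin_cases j <;>
      simp [coe_matD, hc, hb, hd, Real.exp_neg, Real.exp_log (neg_pos.2 hlt), abs_of_neg hlt,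
        -Real.log_abs, -Real.log_neg_eq_log, inv_neg]
  · rw [diagG]
    congr 1
    ext i j
    fin_cases i <;> fin_cases j <;>
      simp [coe_matD, hc, hb, hd, Real.exp_neg, Real.exp_log hgt, abs_of_pos hgt, -Real.log_abs]

/-! ### Endpoints of geodesics and fixed points of translations along them -/

lemma UGeo.exists_hasEnds (γ : UGeo) : ∃ x y, x ≠ y ∧ γ.HasEnds x y := by
  obtain ⟨g, rfl⟩ := γ.exists_eq_smul_stdGeo
  refine ⟨_, _, ?_, stdGeo_hasEnds.smul g⟩
  rw [Ne, smul_left_cancel_iff]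
  exact OnePoint.infty_ne_coe _

/-- Both geodesics are translates of `stdGeo`, by elements that differ by one fixing `∞` and `0`.
Such an element is diagonal and only shifts time on `stdGeo`. -/
lemma UGeo.mk_eq_of_hasEnds {γ η : UGeo} {x y : P1} (hγ : γ.HasEnds x y) (hη : η.HasEnds x y) :
    GeoClass.mk γ = GeoClass.mk η := by
  obtain ⟨g, rfl⟩ := γ.exists_eq_smul_stdGeo
  obtain ⟨h, rfl⟩ := η.exists_eq_smul_stdGeo
  obtain ⟨hx, hy⟩ := hγ.unique (stdGeo_hasEnds.smul g)
  obtain ⟨hx', hy'⟩ := hη.unique (stdGeo_hasEnds.smul h)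
  obtain ⟨s, hs⟩ : ∃ s, g⁻¹ * h = diagG s := by
    apply exists_eq_diagG
    · rw [mul_smul, ← hx', hx, inv_smul_smul]
    · rw [mul_smul, ← hy', hy, inv_smul_smul]
  refine mk_eq_mk_iff.2 ⟨s, ?_⟩
  rw [← UGeo.smul_shift, ← diagG_smul_stdGeo, ← hs, ← mul_smul, mul_inv_cancel_left]

lemma GeoClass.eq_of_hasEnds {c d : GeoClass} {x y : P1} (hc : c.HasEnds x y)
    (hd : d.HasEnds x y) : c = d := by
  obtain ⟨γ, rfl, hγ⟩ := hc
  obtain ⟨η, rfl, hη⟩ := hd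
  exact UGeo.mk_eq_of_hasEnds hγ hη

lemma eq_diagG_of_smul_stdGeo {g : G} {s : ℝ} (h : g • stdGeo = stdGeo.shift s) : g = diagG s := by
  have he := (stdGeo_hasEnds.smul g).unique (h ▸ stdGeo_hasEnds.shift s)
  obtain ⟨r, rfl⟩ := exists_eq_diagG he.1 he.2
  rw [diagG_smul_stdGeo] at h
  have h0 : stdGeo (0 + r) = stdGeo (0 + s) := congrFun (congrArg UGeo.toFun h) 0
  have := stdGeo.isometry.injective h0
  rw [add_right_injective (0 : ℝ) this]

lemma diagG_zero : diagG 0 = 1 := by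
  rw [← map_one toG, diagG]
  congr 1
  ext i j
  fin_cases i <;> fin_cases j <;> simp [coe_matD]

lemma UGeo.eq_one_of_smul_eq {g : G} {γ : UGeo} (h : g • γ = γ) : g = 1 := by
  obtain ⟨a, rfl⟩ := γ.exists_eq_smul_stdGeo
  have h1 : (a⁻¹ * g * a) • stdGeo = stdGeo.shift 0 := by
    rw [mul_smul, mul_smul, h, inv_smul_smul, UGeo.shift_zero]
  have h2 := eq_diagG_of_smul_stdGeo h1
  rw [diagG_zero] at h2
  simpa [mul_assoc, inv_mul_eq_iff_eq_mul] using h2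

lemma UGeo.pow_smul_eq_shift {g : G} {γ : UGeo} {s : ℝ} (h : g • γ = γ.shift s) (n : ℕ) :
    g ^ n • γ = γ.shift (n * s) := by
  induction n with
  | zero => simp [UGeo.shift_zero]
  | succ n ih =>
    rw [pow_succ', mul_smul, ih, UGeo.smul_shift, h, UGeo.shift_shift]
    congr 1; push_cast; ring

lemma coe_diagG_pow_smul (s : ℝ) (n : ℕ) (z : ℍ) :
    ((diagG s ^ n • z : ℍ) : ℂ) = (Real.exp s : ℂ) ^ n * z := by
  induction n with
  | zero => simp
  | succ n ih => rw [pow_succ', mul_smul, coe_diagG_smul, ih]; ring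

lemma coe_diagG_inv_pow_smul (s : ℝ) (n : ℕ) (z : ℍ) :
    (((diagG s)⁻¹ ^ n • z : ℍ) : ℂ) = (Real.exp (-s) : ℂ) ^ n * z := by
  have h : (diagG s)⁻¹ = diagG (-s) := by
    refine inv_eq_of_mul_eq_one_right (UGeo.eq_one_of_smul_eq (γ := stdGeo) ?_)
    rw [mul_smul, diagG_smul_stdGeo, UGeo.smul_shift, diagG_smul_stdGeo, UGeo.shift_shift]
    simp [UGeo.shift_zero]
  rw [h, coe_diagG_pow_smul]

lemma IsHyperbolic.conj {g : G} (h : IsHyperbolic g) (a : G) : IsHyperbolic (a * g * a⁻¹) := by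
  have : {p : ℍ ⊕ P1 | (a * g * a⁻¹) • p = p} = (fun p => a • p) '' {p : ℍ ⊕ P1 | g • p = p} := by
    ext p
    simp only [Set.mem_ofPred_eq, Set.mem_image]
    constructor
    · intro hp
      exact ⟨a⁻¹ • p, by rw [eq_inv_smul_iff, ← mul_smul, ← mul_smul, hp],
        smul_inv_smul a p⟩
    · rintro ⟨p, hp, rfl⟩
      rw [mul_smul, inv_smul_smul, mul_smul, hp]
  rw [IsHyperbolic, this, Set.ncard_image_of_injective _ (MulAction.injective a)]
  exact h

lemma HasFixedPair.conj {g : G} {x y : P1} (h : HasFixedPair g x y) (a : G) :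
    HasFixedPair (a * g * a⁻¹) (a • x) (a • y) := by
  obtain ⟨h1, h2, h3, h4⟩ := h
  refine ⟨h1.conj a, by rw [mul_smul, inv_smul_smul, mul_smul, h2],
    by rw [mul_smul, inv_smul_smul, mul_smul, h3], fun z => ⟨?_, ?_⟩⟩
  · simpa only [conj_pow, mul_smul] using (h4 (a⁻¹ • z)).1.smul a
  · have : (a * g * a⁻¹)⁻¹ = a * g⁻¹ * a⁻¹ := by group
    simpa only [this, conj_pow, mul_smul] using (h4 (a⁻¹ • z)).2.smul a

lemma hasFixedPair_diagG {s : ℝ} (hs : 0 < s) :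
    HasFixedPair (diagG s) OnePoint.infty ((0 : ℝ) : P1) := by
  have hs' : Real.exp s ≠ 1 := by simpa using hs.ne'
  refine ⟨?_, diagG_smul_infty s, by rw [diagG_smul_coe, mul_zero], fun z => ⟨?_, ?_⟩⟩
  · have : {p : ℍ ⊕ P1 | diagG s • p = p} =
        {Sum.inr (OnePoint.infty : P1), Sum.inr ((0 : ℝ) : P1)} := by
      ext p
      simp only [Set.mem_ofPred_eq, Set.mem_insert_iff, Set.mem_singleton_iff]
      rcases p with z | x
      · simp only [Sum.smul_inl, Sum.inl.injEq, reduceCtorEq, or_self, iff_false]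
        intro hz
        have h1 := coe_diagG_smul s z
        rw [hz] at h1
        have h2 := congrArg Complex.im h1
        rw [Complex.im_ofReal_mul] at h2
        exact hs' (mul_right_cancel₀ z.im_pos.ne' ((one_mul _).trans h2).symm)
      · induction x using OnePoint.rec with
        | infty => simp [diagG_smul_infty]
        | coe x =>
          simp only [Sum.smul_inr, diagG_smul_coe, Sum.inr.injEq, OnePoint.coe_eq_coe,
            OnePoint.coe_ne_infty, false_or]
          constructor
          · intro h
            have : (Real.exp s - 1) * x = 0 := by linear_combination h
            exact (mul_eq_zero.1 this).resolve_left (sub_ne_zero.2 hs')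
          · rintro rfl; simp
    rw [IsHyperbolic, this, Set.ncard_pair (by simp [OnePoint.infty_ne_coe])]
  · rw [tendsToBoundary_infty, ← tendsto_norm_atTop_iff_cobounded]
    simp only [coe_diagG_pow_smul, norm_mul, norm_pow, Complex.norm_real, Real.norm_eq_abs,
      Real.abs_exp]
    exact (tendsto_pow_atTop_atTop_of_one_lt (Real.one_lt_exp_iff.2 hs)).atTop_mul_const
      (norm_pos_iff.2 z.ne_zero)
  · rw [tendsToBoundary_coe]
    simp only [coe_diagG_inv_pow_smul]
    have h : Tendsto (fun n : ℕ => (Real.exp (-s) : ℂ) ^ n) atTop (𝓝 0) := by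
      apply tendsto_pow_atTop_nhds_zero_of_norm_lt_one
      rw [Complex.norm_real, Real.norm_eq_abs, Real.abs_exp, Real.exp_lt_one_iff]
      linarith
    simpa using h.mul_const (z : ℂ)

lemma UGeo.hasFixedPair_of_smul_eq_shift {g : G} {γ : UGeo} {s : ℝ} {x y : P1} (hs : 0 < s)
    (h : g • γ = γ.shift s) (he : γ.HasEnds x y) : HasFixedPair g x y := by
  obtain ⟨a, rfl⟩ := γ.exists_eq_smul_stdGeo
  obtain ⟨rfl, rfl⟩ := he.unique (stdGeo_hasEnds.smul a)
  have h1 : (a⁻¹ * g * a) • stdGeo = stdGeo.shift s := by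
    rw [mul_smul, mul_smul, h, UGeo.smul_shift, inv_smul_smul]
  have h2 : g = a * diagG s * a⁻¹ := by
    rw [← eq_diagG_of_smul_stdGeo h1]; group
  rw [h2]
  exact (hasFixedPair_diagG hs).conj a

lemma UGeo.hasDisplacement_of_smul_eq_shift {g : G} {γ : UGeo} {s : ℝ} (hs : 0 < s)
    (h : g • γ = γ.shift s) : HasDisplacement g s := by
  obtain ⟨x, y, -, he⟩ := γ.exists_hasEnds
  exact ⟨hs, γ, x, y, UGeo.hasFixedPair_of_smul_eq_shift hs h he, he, fun t => by rw [h]; rfl⟩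

/-! ### Lifts of periodic geodesics -/

instance (q : ℕ) : Countable (Gam q) := by
  have : Countable (FreeGroup ({S, T q} : Set G)) := inferInstanceAs (Countable (Quot _))
  have h : Countable (FreeGroup.lift fun i : ({S, T q} : Set G) => (i : G)).range :=
    (MonoidHom.rangeRestrict_surjective _).countable
  rw [FreeGroup.range_lift_eq_closure, Subtype.range_coe] at h
  exact h

/-- Pigeonhole: there are uncountably many times and only countably many group elements, so one
element serves two distinct times, and two points determine a geodesic. This lifts equalities of
maps into `X q` to equalities of orbits. -/
lemma UGeo.exists_eq_smul_of_forall {q : ℕ} {γ η : UGeo}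
    (h : ∀ t, ∃ g ∈ Gam q, η t = g • γ t) : ∃ g ∈ Gam q, η = g • γ := by
  choose g hg h using h
  by_contra! hne
  have hinj : Function.Injective fun t => (⟨g t, hg t⟩ : Gam q) := by
    intro r s hrs
    by_contra hrs'
    have hrs : g r = g s := congrArg Subtype.val hrs
    exact hne (g r) (hg r) (UGeo.eq_of_eq_of_eq hrs' (h r) (by rw [h s, hrs]; rfl))
  exact Cardinal.not_countable_real (Set.countable_univ_iff.2 hinj.countable)

lemma GeoX.eval_proj_eq_iff {q : ℕ} {γ η : UGeo} {s t : ℝ} :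
    (GeoX.proj q γ).eval s = (GeoX.proj q η).eval t ↔ ∃ g ∈ Gam q, γ s = g • η t := by
  refine Quotient.eq.trans ?_
  constructor
  · rintro ⟨g, hg⟩; exact ⟨g, g.2, hg.symm⟩
  · rintro ⟨g, hg, h⟩; exact ⟨⟨g, hg⟩, h.symm⟩

lemma GeoX.proj_smul {q : ℕ} {g : G} (hg : g ∈ Gam q) (γ : UGeo) :
    GeoX.proj q (g • γ) = GeoX.proj q γ :=
  Quotient.sound ⟨⟨g, hg⟩, rfl⟩

/-- `c(+∞) > 0 > c(-∞)`. -/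
def GeoClass.IsReduced (c : GeoClass) : Prop :=
  ∃ x y : P1, c.HasEnds x y ∧ P1Lt (0 : ℝ) x ∧ P1Lt y (0 : ℝ)

lemma GeoClass.isReduced_mk {γ : UGeo} : (GeoClass.mk γ).IsReduced ↔ γ.IsReduced :=
  exists_congr fun _ => exists_congr fun _ => and_congr_left' GeoClass.hasEnds_mk

lemma IsReducedLift.isReduced {q : ℕ} {ch : PGeoClass q} {c : GeoClass} (h : IsReducedLift ch c) :
    c.IsReduced := by
  obtain ⟨γ, -, rfl, -, -, h⟩ := h
  exact GeoClass.isReduced_mk.2 h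

lemma isReducedLift_iff {q : ℕ} {ch : PGeoClass q} {c d : GeoClass} (h : IsReducedLift ch c) :
    IsReducedLift ch d ↔ (∃ g ∈ Gam q, d = g • c) ∧ d.IsReduced := by
  obtain ⟨γ, γh, rfl, rfl, hγ, -⟩ := h
  constructor
  · refine fun hd => ⟨?_, hd.isReduced⟩
    obtain ⟨η, ηh, rfl, he, hη, -⟩ := hd
    obtain ⟨s, hs⟩ := Quotient.exact he
    rw [← hγ, ← hη] at hs
    obtain ⟨g, hg, h⟩ := UGeo.exists_eq_smul_of_forall (η := γ) (γ := η.shift s)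
      fun t => GeoX.eval_proj_eq_iff.1 (hs t)
    refine ⟨g⁻¹, inv_mem hg, ?_⟩
    rw [h, GeoClass.smul_mk, inv_smul_smul]
    exact mk_eq_mk_iff.2 ⟨s, rfl⟩
  · rintro ⟨⟨g, hg, rfl⟩, hr⟩
    exact ⟨g • γ, γh, rfl, rfl, by rw [GeoX.proj_smul hg, hγ], GeoClass.isReduced_mk.1 hr⟩

lemma IsReducedLift.exists_smul_eq {q : ℕ} {ch : PGeoClass q} {c : GeoClass}
    (h : IsReducedLift ch c) : ∃ g ∈ Gam q, g ≠ 1 ∧ g • c = c := by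
  obtain ⟨γ, γh, rfl, rfl, hγ, -⟩ := h
  obtain ⟨t₀, ht₀, hper⟩ := γh.periodic
  rw [← hγ] at hper
  obtain ⟨g, hg, h⟩ := UGeo.exists_eq_smul_of_forall (η := γ) (γ := γ.shift t₀)
      fun t => GeoX.eval_proj_eq_iff.1 (hper t)
  refine ⟨g, hg, ?_, ?_⟩
  · rintro rfl
    rw [one_smul] at h
    have h0 : γ 0 = γ (0 + t₀) := congrFun (congrArg UGeo.toFun h) 0
    have := γ.isometry.injective h0
    linarith
  · rw [eq_comm, GeoClass.smul_mk, mk_eq_mk_iff]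
    refine ⟨-t₀, ?_⟩
    rw [UGeo.smul_shift] at h
    conv_rhs => rw [h]
    rw [UGeo.shift_shift, add_neg_cancel, UGeo.shift_zero]

lemma GeoClass.HasEnds.ne {c : GeoClass} {x y : P1} (h : c.HasEnds x y) : x ≠ y := by
  obtain ⟨γ, rfl, h⟩ := h
  obtain ⟨x', y', hne, h'⟩ := γ.exists_hasEnds
  obtain ⟨rfl, rfl⟩ := h.unique h'
  exact hne

/-! ### Matrices dominating the identity -/

/-- All entries of `A` are at least those of the identity matrix. -/
structure DominatesOne (A : SL(2, ℝ)) : Prop where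
  one_le_a : 1 ≤ A 0 0
  one_le_d : 1 ≤ A 1 1
  b_nonneg : 0 ≤ A 0 1
  c_nonneg : 0 ≤ A 1 0

lemma mul_apply_two (A B : SL(2, ℝ)) (i j : Fin 2) :
    (A * B) i j = A i 0 * B 0 j + A i 1 * B 1 j := by
  rw [Matrix.SpecialLinearGroup.coe_mul, Matrix.mul_apply, Fin.sum_univ_two]

lemma DominatesOne.one : DominatesOne 1 := by
  constructor <;> simp

lemma DominatesOne.mul {A B : SL(2, ℝ)} (hA : DominatesOne A) (hB : DominatesOne B) :
    DominatesOne (A * B) := by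
  obtain ⟨a1, a2, a3, a4⟩ := hA
  obtain ⟨b1, b2, b3, b4⟩ := hB
  constructor <;> rw [mul_apply_two]
  · nlinarith [mul_nonneg a3 b4]
  · nlinarith [mul_nonneg a4 b3]
  · positivity
  · positivity

/-- The off-diagonal sum cannot decrease under multiplication by a dominating matrix. It vanishes
for `1` and `-1`, so this keeps nonempty words nontrivial in `PSL₂`. -/
lemma DominatesOne.offDiag_mul {A B : SL(2, ℝ)} (hA : DominatesOne A) (hB : DominatesOne B)
    (h : 0 < A 0 1 + A 1 0) : 0 < (A * B) 0 1 + (A * B) 1 0 := by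
  obtain ⟨a1, a2, a3, a4⟩ := hA
  obtain ⟨b1, b2, b3, b4⟩ := hB
  rw [mul_apply_two, mul_apply_two]
  nlinarith [mul_nonneg (sub_nonneg.2 a1) b3, mul_nonneg (sub_nonneg.2 a2) b4,
    mul_nonneg a3 (sub_nonneg.2 b2), mul_nonneg a4 (sub_nonneg.2 b1)]

/-! ### Signs on `P¹(ℝ)` -/

lemma P1Lt_coe_coe {a b : ℝ} : P1Lt (a : P1) (b : P1) ↔ a < b := by
  constructor
  · rintro ⟨c, hc, h⟩
    rw [OnePoint.coe_eq_coe] at hc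
    rw [hc]; exact h b rfl
  · intro h
    exact ⟨a, rfl, fun c hc => by rwa [← OnePoint.coe_eq_coe.1 hc]⟩

lemma P1Lt_coe_infty (a : ℝ) : P1Lt (a : P1) OnePoint.infty :=
  ⟨a, rfl, fun _ h => absurd h (OnePoint.infty_ne_coe _)⟩

lemma P1Lt.exists_coe {x y : P1} (h : P1Lt x y) : ∃ a : ℝ, x = a := ⟨h.choose, h.choose_spec.1⟩

lemma coe_matS : (matS : Matrix (Fin 2) (Fin 2) ℝ) = !![0, 1; -1, 0] := rfl

lemma coe_matT (q : ℕ) :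
    (matT q : Matrix (Fin 2) (Fin 2) ℝ) = !![1, 2 * Real.cos (Real.pi / q); 0, 1] := rfl

lemma S_smul_infty : S • (OnePoint.infty : P1) = ((0 : ℝ) : P1) := by
  rw [S, toG_smul_infty, if_neg (by simp [matS])]; simp [matS]

lemma S_smul_coe {x : ℝ} (hx : x ≠ 0) : S • (x : P1) = ((-x⁻¹ : ℝ) : P1) := by
  rw [S, toG_smul_coe, if_neg (by simp [matS, hx])]
  congr 1
  simp [matS]

lemma S_mul_S : S * S = 1 := by
  rw [S, ← map_mul, ← map_one toG, ← toG_neg]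
  congr 1
  ext i j
  fin_cases i <;> fin_cases j <;> simp [coe_matS]

lemma S_inv : S⁻¹ = S := inv_eq_of_mul_eq_one_right S_mul_S

lemma not_pos_S_smul {x : P1} (hx : P1Lt (0 : ℝ) x) : ¬ P1Lt (0 : ℝ) (S • x) := by
  induction x using OnePoint.rec with
  | infty => rw [S_smul_infty, P1Lt_coe_coe]; exact lt_irrefl 0
  | coe x =>
    rw [P1Lt_coe_coe] at hx
    rw [S_smul_coe hx.ne', P1Lt_coe_coe]
    have := inv_pos.2 hx
    linarith

lemma pos_S_smul {y : P1} (hy : P1Lt y (0 : ℝ)) : P1Lt (0 : ℝ) (S • y) := by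
  obtain ⟨y, rfl⟩ := hy.exists_coe
  rw [P1Lt_coe_coe] at hy
  rw [S_smul_coe hy.ne, P1Lt_coe_coe]
  have := inv_lt_zero.2 hy
  linarith

lemma not_neg_of_pos {x : P1} (hx : P1Lt (0 : ℝ) x) : ¬ P1Lt x (0 : ℝ) := by
  intro h
  obtain ⟨y, rfl⟩ := h.exists_coe
  rw [P1Lt_coe_coe] at h hx
  exact lt_asymm h hx

lemma DominatesOne.smul_coe {A : SL(2, ℝ)} (hA : DominatesOne A) {x : ℝ} (hx : 0 < x) :
    0 < A 1 0 * x + A 1 1 ∧ 0 < A 0 0 * x + A 0 1 ∧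
      toG A • (x : P1) = (((A 0 0 * x + A 0 1) / (A 1 0 * x + A 1 1) : ℝ) : P1) := by
  obtain ⟨a1, a2, a3, a4⟩ := hA
  have h : 0 < A 1 0 * x + A 1 1 := by nlinarith [mul_nonneg a4 hx.le]
  refine ⟨h, by nlinarith, ?_⟩
  rw [toG_smul_coe, if_neg h.ne']

lemma DominatesOne.pos_smul {A : SL(2, ℝ)} (hA : DominatesOne A) {x : P1}
    (hx : P1Lt (0 : ℝ) x) : P1Lt (0 : ℝ) (toG A • x) := by
  induction x using OnePoint.rec with
  | infty =>
    rw [toG_smul_infty]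
    split_ifs with h
    · exact P1Lt_coe_infty 0
    · rw [P1Lt_coe_coe]
      exact div_pos (by linarith [hA.one_le_a]) (lt_of_le_of_ne hA.c_nonneg (Ne.symm h))
  | coe x =>
    rw [P1Lt_coe_coe] at hx
    obtain ⟨h1, h2, h3⟩ := hA.smul_coe hx
    rw [h3, P1Lt_coe_coe]
    exact div_pos h2 h1

lemma DominatesOne.neg_inv_smul {A : SL(2, ℝ)} (hA : DominatesOne A) {y : P1}
    (hy : P1Lt y (0 : ℝ)) : P1Lt ((toG A)⁻¹ • y) (0 : ℝ) := by
  obtain ⟨y, rfl⟩ := hy.exists_coe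
  rw [P1Lt_coe_coe] at hy
  obtain ⟨a1, a2, a3, a4⟩ := hA
  have e : (A⁻¹ : SL(2, ℝ)) 0 0 = A 1 1 ∧ (A⁻¹ : SL(2, ℝ)) 0 1 = -A 0 1 ∧
      (A⁻¹ : SL(2, ℝ)) 1 0 = -A 1 0 ∧ (A⁻¹ : SL(2, ℝ)) 1 1 = A 0 0 := by
    simp [Matrix.SpecialLinearGroup.SL2_inv_expl]
  have h : 0 < -A 1 0 * y + A 0 0 := by nlinarith [mul_nonneg a4 (neg_pos.2 hy).le]
  rw [← map_inv, toG_smul_coe, e.1, e.2.1, e.2.2.1, e.2.2.2, if_neg h.ne', P1Lt_coe_coe]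
  exact div_neg_of_neg_of_pos (by nlinarith) h

/-! ### The generators `g_k⁻¹` -/

/-- The entries obey the recursion `sin ((k+1)θ) = 2 cos θ sin (kθ) - sin ((k-1)θ)`. The factor `sin
θ` is kept on the left to avoid division. -/
lemma T_mul_S_pow (q k : ℕ) : ∃ A : SL(2, ℝ), (T q * S) ^ k * S = toG A ∧
    Real.sin (Real.pi / q) * A 0 0 = Real.sin (k * (Real.pi / q)) ∧
    Real.sin (Real.pi / q) * A 0 1 = Real.sin ((k + 1) * (Real.pi / q)) ∧
    Real.sin (Real.pi / q) * A 1 0 = Real.sin ((k - 1) * (Real.pi / q)) ∧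
    Real.sin (Real.pi / q) * A 1 1 = Real.sin (k * (Real.pi / q)) := by
  set θ := Real.pi / q with hθ
  induction k with
  | zero => exact ⟨matS, by simp [S], by simp [matS], by simp [matS], by simp [matS], by simp [matS]⟩
  | succ k ih =>
    obtain ⟨A, h, h1, h2, h3, h4⟩ := ih
    have key : ∀ x : ℝ, Real.sin ((x + 1) * θ) = 2 * Real.cos θ * Real.sin (x * θ) -
        Real.sin ((x - 1) * θ) := by
      intro x
      rw [add_mul, sub_mul, one_mul, Real.sin_add, Real.sin_sub]; ring
    -- The sign is free in `PSL₂`; negating at each step makes the recursion come out as that of the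
    -- sines.
    have hU : ∀ i j, (-(matT q * matS * A)) i j =
        if i = 0 then 2 * Real.cos θ * A 0 j - A 1 j else A 0 j := by
      intro i j
      fin_cases i
      · simp [coe_matT, coe_matS, Matrix.vecMul, dotProduct, Fin.sum_univ_two, ← hθ]; ring
      · simp [coe_matT, coe_matS, Matrix.vecMul, dotProduct, Fin.sum_univ_two]
    refine ⟨-(matT q * matS * A), ?_, ?_, ?_, ?_, ?_⟩
    · rw [toG_neg, map_mul, ← h, pow_succ', mul_assoc (T q * S), map_mul]; rfl
    · rw [hU, if_pos rfl]
      push_cast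
      rw [key, ← h1, ← h3]; ring
    · rw [hU, if_pos rfl]
      push_cast
      rw [key, add_sub_cancel_right, ← h2, ← h4]; ring
    · rw [hU, if_neg (by decide)]
      push_cast
      rw [add_sub_cancel_right, h1]
    · rw [hU, if_neg (by decide)]
      push_cast
      rw [h2]

lemma gk_inv (q k : ℕ) : (gk q k)⁻¹ = (T q * S) ^ k * S := inv_inv _

lemma sin_angle_pos {q : ℕ} (hq : 3 ≤ q) : 0 < Real.sin (Real.pi / q) := by
  have : (3 : ℝ) ≤ q := by exact_mod_cast hq
  apply Real.sin_pos_of_pos_of_lt_pi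
  · exact div_pos Real.pi_pos (by linarith)
  · rw [div_lt_iff₀ (by linarith)]; nlinarith [Real.pi_pos]

lemma cos_angle_pos {q : ℕ} (hq : 3 ≤ q) : 0 < Real.cos (Real.pi / q) := by
  have : (3 : ℝ) ≤ q := by exact_mod_cast hq
  have h : 0 < Real.pi / q := div_pos Real.pi_pos (by linarith)
  apply Real.cos_pos_of_mem_Ioo ⟨by linarith [Real.pi_pos], ?_⟩
  rw [div_lt_iff₀ (by linarith)]; nlinarith [Real.pi_pos]

lemma T_mul_S_pow_self {q : ℕ} (hq : 3 ≤ q) : (T q * S) ^ q = 1 := by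
  obtain ⟨A, h, h1, h2, h3, h4⟩ := T_mul_S_pow q q
  have hq0 : (q : ℝ) ≠ 0 := by positivity
  have hs := (sin_angle_pos hq).ne'
  have e1 : (q : ℝ) * (Real.pi / q) = Real.pi := by field_simp
  rw [e1, Real.sin_pi] at h1 h4
  rw [add_mul, e1, one_mul, add_comm, Real.sin_add_pi] at h2
  rw [sub_mul, e1, one_mul, Real.sin_pi_sub] at h3
  have hA : A = -matS := by
    ext i j
    apply mul_left_cancel₀ hs
    fin_cases i <;> fin_cases j <;> simp [coe_matS, h1, h2, h3, h4, -mul_eq_mul_left_iff]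
  rw [hA, toG_neg] at h
  exact mul_eq_right.1 h

/-- From `θ ≤ kθ ≤ π - θ` follows `sin θ ≤ sin kθ`. The off-diagonal sum is `2 sin kθ cos θ / sin
θ`, and `cos θ > 0` because `q ≥ 3`. -/
lemma dominatesOne_of_sin {q k : ℕ} (hq : 3 ≤ q) (hk : 1 ≤ k) (hk' : k ≤ q - 1) {A : SL(2, ℝ)}
    (h1 : Real.sin (Real.pi / q) * A 0 0 = Real.sin (k * (Real.pi / q)))
    (h2 : Real.sin (Real.pi / q) * A 0 1 = Real.sin ((k + 1) * (Real.pi / q)))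
    (h3 : Real.sin (Real.pi / q) * A 1 0 = Real.sin ((k - 1) * (Real.pi / q)))
    (h4 : Real.sin (Real.pi / q) * A 1 1 = Real.sin (k * (Real.pi / q))) :
    DominatesOne A ∧ 0 < A 0 1 + A 1 0 := by
  have hs := sin_angle_pos hq
  have hc := cos_angle_pos hq
  have hkR : (1 : ℝ) ≤ k := by exact_mod_cast hk
  have hkR' : (k : ℝ) + 1 ≤ q := by exact_mod_cast (by omega : k + 1 ≤ q)
  set θ := Real.pi / q with hθ
  have hq0 : 0 < (q : ℝ) := by linarith
  have hθ0 : 0 < θ := div_pos Real.pi_pos hq0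
  have hθq : q * θ = Real.pi := by rw [hθ]; field_simp
  have hle : (k + 1) * θ ≤ Real.pi := by rw [← hθq]; gcongr
  have hmain : Real.sin θ ≤ Real.sin (k * θ) := by
    rw [← sub_nonneg, Real.sin_sub_sin]
    have e1 : 0 ≤ Real.sin ((k * θ - θ) / 2) := by
      apply Real.sin_nonneg_of_nonneg_of_le_pi <;> nlinarith
    have e2 : 0 ≤ Real.cos ((k * θ + θ) / 2) := by
      apply Real.cos_nonneg_of_neg_pi_div_two_le_of_le <;> nlinarith
    positivity
  refine ⟨⟨?_, ?_, ?_, ?_⟩, ?_⟩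
  · rw [← mul_le_mul_iff_right₀ hs, h1, mul_one]; exact hmain
  · rw [← mul_le_mul_iff_right₀ hs, h4, mul_one]; exact hmain
  · rw [← mul_le_mul_iff_right₀ hs, h2, mul_zero]
    exact Real.sin_nonneg_of_nonneg_of_le_pi (by positivity) hle
  · rw [← mul_le_mul_iff_right₀ hs, h3, mul_zero]
    exact Real.sin_nonneg_of_nonneg_of_le_pi (by nlinarith) (by nlinarith)
  · apply pos_of_mul_pos_right _ hs.le
    rw [mul_add, h2, h3, add_mul, sub_mul, one_mul, Real.sin_add, Real.sin_sub]
    have := mul_pos (hs.trans_le hmain) hc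
    linarith

lemma gk_inv_matrix {q k : ℕ} (hq : 3 ≤ q) (hk : 1 ≤ k) (hk' : k ≤ q - 1) :
    ∃ A : SL(2, ℝ), (gk q k)⁻¹ = toG A ∧ DominatesOne A ∧ 0 < A 0 1 + A 1 0 := by
  obtain ⟨A, h, h1, h2, h3, h4⟩ := T_mul_S_pow q k
  exact ⟨A, by rw [gk_inv, h], dominatesOne_of_sin hq hk hk' h1 h2 h3 h4⟩

/-! ### Words in the generators `g_k⁻¹` -/

/-- All letters lie in `{1, …, q - 1}`. -/
def IsWord (q : ℕ) (l : List ℕ) : Prop := ∀ k ∈ l, 1 ≤ k ∧ k ≤ q - 1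

/-- The product of the `g_k⁻¹`, for `k` running through the list `l`. -/
def wordProd (q : ℕ) (l : List ℕ) : G := (l.map fun k => (gk q k)⁻¹).prod

lemma wordProd_cons (q k : ℕ) (l : List ℕ) :
    wordProd q (k :: l) = (gk q k)⁻¹ * wordProd q l := by
  simp [wordProd]

lemma wordProd_append (q : ℕ) (l l' : List ℕ) :
    wordProd q (l ++ l') = wordProd q l * wordProd q l' := by
  simp [wordProd]

lemma wordProd_nil (q : ℕ) : wordProd q [] = 1 := rfl

lemma isWord_nil (q : ℕ) : IsWord q [] := by simp [IsWord]

lemma isWord_cons {q k : ℕ} {l : List ℕ} :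
    IsWord q (k :: l) ↔ (1 ≤ k ∧ k ≤ q - 1) ∧ IsWord q l := by
  simp [IsWord]

lemma gk_mem (q k : ℕ) : gk q k ∈ Gam q := by
  have hS : S ∈ Gam q := Subgroup.subset_closure (by simp)
  have hT : T q ∈ Gam q := Subgroup.subset_closure (by simp)
  exact inv_mem (mul_mem (pow_mem (mul_mem hT hS) _) hS)

lemma wordProd_matrix {q : ℕ} (hq : 3 ≤ q) {l : List ℕ} (hl : IsWord q l) :
    ∃ A : SL(2, ℝ), wordProd q l = toG A ∧ DominatesOne A ∧ (l ≠ [] → 0 < A 0 1 + A 1 0) := by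
  induction l with
  | nil => exact ⟨1, by rw [wordProd_nil, map_one], DominatesOne.one, fun h => absurd rfl h⟩
  | cons k l ih =>
    rw [isWord_cons] at hl
    obtain ⟨A, hA, hA1, hA2⟩ := gk_inv_matrix hq hl.1.1 hl.1.2
    obtain ⟨B, hB, hB1, -⟩ := ih hl.2
    exact ⟨A * B, by rw [wordProd_cons, hA, hB, map_mul], hA1.mul hB1,
      fun _ => hA1.offDiag_mul hB1 hA2⟩

lemma pos_wordProd_smul {q : ℕ} (hq : 3 ≤ q) {l : List ℕ} (hl : IsWord q l) {x : P1}
    (hx : P1Lt (0 : ℝ) x) : P1Lt (0 : ℝ) (wordProd q l • x) := by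
  obtain ⟨A, hA, hA1, -⟩ := wordProd_matrix hq hl
  rw [hA]; exact hA1.pos_smul hx

lemma neg_wordProd_inv_smul {q : ℕ} (hq : 3 ≤ q) {l : List ℕ} (hl : IsWord q l) {y : P1}
    (hy : P1Lt y (0 : ℝ)) : P1Lt ((wordProd q l)⁻¹ • y) (0 : ℝ) := by
  obtain ⟨A, hA, hA1, -⟩ := wordProd_matrix hq hl
  rw [hA]; exact hA1.neg_inv_smul hy

/-- `g` is a word in the `g_k⁻¹`, up to factors `S` at both ends. -/
def IsWordForm (q : ℕ) (g : G) : Prop :=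
  ∃ l r, IsWord q l ∧ (r = 1 ∨ r = S) ∧ (g = wordProd q l * r ∨ g = S * wordProd q l * r)

lemma IsWordForm.S_mul {q : ℕ} {g : G} (h : IsWordForm q g) : IsWordForm q (S * g) := by
  obtain ⟨l, r, hl, hr, rfl | rfl⟩ := h
  · exact ⟨l, r, hl, hr, Or.inr (mul_assoc _ _ _).symm⟩
  · refine ⟨l, r, hl, hr, Or.inl ?_⟩
    rw [← mul_assoc, ← mul_assoc, S_mul_S, one_mul]

/-- A factor `U` on the left raises the first letter by one. A first letter `q - 1` becomes `U ^ q *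
S = S`, and a leading `S` becomes the letter `1`, since `U * S = (gk q 1)⁻¹`. -/
lemma IsWordForm.T_mul_S_mul {q : ℕ} (hq : 3 ≤ q) {g : G} (h : IsWordForm q g) :
    IsWordForm q (T q * S * g) := by
  have h1 : (gk q 1)⁻¹ = T q * S * S := by rw [gk_inv, pow_one]
  have hsucc : ∀ k, T q * S * (gk q k)⁻¹ = (gk q (k + 1))⁻¹ := fun k => by
    rw [gk_inv, gk_inv, pow_succ', mul_assoc (T q * S)]
  obtain ⟨l, r, hl, hr, rfl | rfl⟩ := h
  · rcases l with _ | ⟨k, l⟩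
    -- With no letter to raise, write `U * r = (U * S) * (S * r)`.
    · refine ⟨[1], S * r, by simp [IsWord]; omega, ?_, Or.inl ?_⟩
      · rcases hr with rfl | rfl
        · right; rw [mul_one]
        · left; rw [S_mul_S]
      · rw [wordProd_cons, wordProd_nil, h1, mul_one, one_mul, mul_assoc (T q * S) S,
          ← mul_assoc S S, S_mul_S, one_mul]
    · rw [isWord_cons] at hl
      rcases Nat.lt_or_ge k (q - 1) with hk | hk
      · refine ⟨(k + 1) :: l, r, isWord_cons.2 ⟨by omega, hl.2⟩, hr, Or.inl ?_⟩
        rw [wordProd_cons, wordProd_cons, ← hsucc]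
        simp only [mul_assoc]
      · refine ⟨l, r, hl.2, hr, Or.inr ?_⟩
        have hS : S = (gk q (k + 1))⁻¹ := by
          rw [gk_inv, show k + 1 = q by omega, T_mul_S_pow_self hq, one_mul]
        conv_rhs => rw [hS, ← hsucc]
        rw [wordProd_cons]
        simp only [mul_assoc]
  · refine ⟨1 :: l, r, isWord_cons.2 ⟨by omega, hl⟩, hr, Or.inl ?_⟩
    rw [wordProd_cons, h1]
    simp only [mul_assoc]

lemma isWordForm_of_mem {q : ℕ} (hq : 3 ≤ q) {g : G} (hg : g ∈ Gam q) : IsWordForm q g := by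
  have hT : ∀ g, T q * g = T q * S * (S * g) := fun g => by
    rw [mul_assoc, ← mul_assoc S, S_mul_S, one_mul]
  have hT' : ∀ g, (T q)⁻¹ * g = S * ((T q * S) ^ (q - 1) * g) := fun g => by
    have h1 : (T q * S) ^ (q - 1) = (T q * S)⁻¹ := by
      rw [eq_inv_iff_mul_eq_one, ← pow_succ, show q - 1 + 1 = q by omega, T_mul_S_pow_self hq]
    rw [h1, mul_inv_rev, S_inv, ← mul_assoc, ← mul_assoc, S_mul_S, one_mul]
  have hpow : ∀ (n : ℕ) g, IsWordForm q g → IsWordForm q ((T q * S) ^ n * g) := by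
    intro n g h
    induction n with
    | zero => rwa [pow_zero, one_mul]
    | succ n ih => rw [pow_succ', mul_assoc]; exact ih.T_mul_S_mul hq
  induction hg using Subgroup.closure_induction_left with
  | one => exact ⟨[], 1, isWord_nil q, Or.inl rfl, Or.inl (by simp [wordProd_nil])⟩
  | mul_left x hx y _ ih =>
    rcases hx with rfl | rfl
    · exact ih.S_mul
    · rw [hT]; exact ih.S_mul.T_mul_S_mul hq
  | inv_mul_cancel x hx y _ ih =>
    rcases hx with rfl | rfl
    · rw [S_inv]; exact ih.S_mul
    · rw [hT']; exact (hpow _ _ ih).S_mul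

/-- Conjugation by `S` turns the letter `U ^ k * S` into `S * U ^ k = gk q (q - k)`, an inverse
letter, so the new word is read in reverse order. -/
lemma exists_S_mul_wordProd_mul_S {q : ℕ} (hq : 3 ≤ q) {l : List ℕ} (hl : IsWord q l) :
    ∃ l', IsWord q l' ∧ S * wordProd q l * S = (wordProd q l')⁻¹ := by
  induction l with
  | nil => exact ⟨[], isWord_nil q, by rw [wordProd_nil, mul_one, S_mul_S, inv_one]⟩
  | cons k l ih =>
    rw [isWord_cons] at hl
    obtain ⟨l', hl', h⟩ := ih hl.2
    refine ⟨l' ++ [q - k], ?_, ?_⟩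
    · intro j hj
      rcases List.mem_append.1 hj with hj | hj
      · exact hl' j hj
      · rw [List.mem_singleton] at hj; omega
    · have hk : gk q (q - k) = S * (T q * S) ^ k := by
        rw [gk, mul_inv_rev, S_inv]
        congr 1
        rw [inv_eq_iff_mul_eq_one, ← pow_add, Nat.sub_add_cancel (by omega), T_mul_S_pow_self hq]
      rw [wordProd_append, wordProd_cons, wordProd_cons, wordProd_nil, mul_one, mul_inv_rev, inv_inv,
        ← h, hk, gk_inv]
      simp only [mul_assoc]

/-- For a word `w`, the form `S * w` sends the positive endpoint to a nonpositive one and `w * S`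
sends the negative endpoint to a positive one. Only `w` and `S * w * S`, the inverse of a word,
survive. -/
lemma exists_wordProd_of_isReduced {q : ℕ} (hq : 3 ≤ q) {c : GeoClass} {g : G} (hg : g ∈ Gam q)
    (hc : c.IsReduced) (hgc : (g • c).IsReduced) :
    ∃ l, IsWord q l ∧ (g = wordProd q l ∨ g = (wordProd q l)⁻¹) := by
  obtain ⟨x, y, he, hx, hy⟩ := hc
  obtain ⟨x', y', he', hx', hy'⟩ := hgc
  obtain ⟨rfl, rfl⟩ := he'.unique (he.smul g)
  obtain ⟨l, r, hl, rfl | rfl, rfl | rfl⟩ := isWordForm_of_mem hq hg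
  · exact ⟨l, hl, Or.inl (mul_one _)⟩
  · rw [mul_one, mul_smul] at hx'
    exact absurd hx' (not_pos_S_smul (pos_wordProd_smul hq hl hx))
  · rw [mul_smul] at hy'
    exact absurd hy' (not_neg_of_pos (pos_wordProd_smul hq hl (pos_S_smul hy)))
  · obtain ⟨l', hl', h⟩ := exists_S_mul_wordProd_mul_S hq hl
    exact ⟨l', hl', Or.inr h⟩

/-! ### The intervals `(g_k⁻¹.0, g_k⁻¹.∞)` -/

lemma DominatesOne.mem_interval_iff {A : SL(2, ℝ)} (hA : DominatesOne A) {x : P1} :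
    P1Lt (toG A • ((0 : ℝ) : P1)) x ∧ P1Lt x (toG A • (OnePoint.infty : P1)) ↔
      ∃ u : ℝ, 0 < u ∧ x = toG A • (u : P1) := by
  have hdet := det_eq_one A
  have ha : 0 < A 0 0 := by linarith [hA.one_le_a]
  have hd : 0 < A 1 1 := by linarith [hA.one_le_d]
  have hc := hA.c_nonneg
  have h0 : toG A • ((0 : ℝ) : P1) = ((A 0 1 / A 1 1 : ℝ) : P1) := by
    rw [toG_smul_coe, if_neg (by simpa using hd.ne')]; simp
  rw [h0, toG_smul_infty]
  constructor
  · rintro ⟨h1, h2⟩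
    obtain ⟨x, rfl⟩ := h2.exists_coe
    rw [P1Lt_coe_coe, div_lt_iff₀ hd] at h1
    have h3 : 0 < A 0 0 - A 1 0 * x := by
      split_ifs at h2 with h
      · rw [h]; linarith
      · rw [P1Lt_coe_coe, lt_div_iff₀ (lt_of_le_of_ne hc (Ne.symm h))] at h2
        linarith
    -- This is the preimage of `x` under `A`.
    have hu : 0 < (A 1 1 * x - A 0 1) / (A 0 0 - A 1 0 * x) := div_pos (by linarith) h3
    refine ⟨_, hu, ?_⟩
    obtain ⟨h4, -, h5⟩ := hA.smul_coe hu
    rw [h5, OnePoint.coe_eq_coe, eq_div_iff h4.ne']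
    linear_combination -div_mul_cancel₀ (A 1 1 * x - A 0 1) h3.ne'
  · rintro ⟨u, hu, rfl⟩
    obtain ⟨h4, -, h5⟩ := hA.smul_coe hu
    rw [h5]
    constructor
    · rw [P1Lt_coe_coe, div_lt_div_iff₀ hd h4]
      nlinarith
    · split_ifs with h
      · exact P1Lt_coe_infty _
      · rw [P1Lt_coe_coe, div_lt_div_iff₀ h4 (lt_of_le_of_ne hc (Ne.symm h))]
        nlinarith

lemma isIntervalIndex_iff {q : ℕ} (hq : 3 ≤ q) {c : GeoClass} {k : ℕ} :
    IsIntervalIndex q c k ↔ (1 ≤ k ∧ k ≤ q - 1) ∧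
      ∃ (u : ℝ) (y : P1), 0 < u ∧ c.HasEnds ((gk q k)⁻¹ • (u : P1)) y := by
  rw [IsIntervalIndex, ← and_assoc]
  refine and_congr_right fun hk => ?_
  obtain ⟨A, hA, hA1, -⟩ := gk_inv_matrix hq hk.1 hk.2
  rw [hA]
  constructor
  · rintro ⟨x, y, he, hx⟩
    obtain ⟨u, hu, rfl⟩ := hA1.mem_interval_iff.1 hx
    exact ⟨u, y, hu, he⟩
  · rintro ⟨u, y, hu, he⟩
    exact ⟨_, y, he, hA1.mem_interval_iff.2 ⟨u, hu, rfl⟩⟩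

/-- Cancelling `U ^ j` from `g_j⁻¹.u = g_k⁻¹.u'` leaves `S.u = g_{k-j}⁻¹.u'`, whose left side is
negative and right side positive. -/
lemma IsIntervalIndex.not_idx_lt {q : ℕ} (hq : 3 ≤ q) {c : GeoClass} {j k : ℕ}
    (hj : IsIntervalIndex q c j) (hk : IsIntervalIndex q c k) : ¬ j < k := by
  intro hjk
  rw [isIntervalIndex_iff hq] at hj hk
  obtain ⟨hj, u, y, hu, he⟩ := hj
  obtain ⟨hk, u', y', hu', he'⟩ := hk
  have h1 := (he.unique he').1
  have h2 : (gk q k)⁻¹ = (T q * S) ^ j * (gk q (k - j))⁻¹ := by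
    rw [gk_inv, gk_inv, ← mul_assoc, ← pow_add, Nat.add_sub_cancel' hjk.le]
  rw [h2, gk_inv, mul_smul, mul_smul, smul_left_cancel_iff] at h1
  obtain ⟨A, hA, hA1, -⟩ := gk_inv_matrix (k := k - j) hq (by omega) (by omega)
  refine not_pos_S_smul (P1Lt_coe_coe.2 hu) ?_
  rw [h1, hA]
  exact hA1.pos_smul (P1Lt_coe_coe.2 hu')

lemma IsIntervalIndex.unique {q : ℕ} (hq : 3 ≤ q) {c : GeoClass} {j k : ℕ}
    (hj : IsIntervalIndex q c j) (hk : IsIntervalIndex q c k) : j = k :=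
  le_antisymm (not_lt.1 (hk.not_idx_lt hq hj)) (not_lt.1 (hj.not_idx_lt hq hk))

/-- Neighbouring intervals share an endpoint: `g_{k-1}⁻¹.0 = g_k⁻¹.∞`. Taking the least `k` with
`g_k⁻¹.0 < x`, minimality gives `x ≤ g_k⁻¹.∞`, and the hypothesis excludes equality. -/
lemma exists_eq_gk_inv_smul {q : ℕ} (hq : 3 ≤ q) {x : ℝ} (hx : 0 < x)
    (h : ∀ k, (gk q k)⁻¹ • (OnePoint.infty : P1) ≠ x) :
    ∃ k, (1 ≤ k ∧ k ≤ q - 1) ∧ ∃ u : ℝ, 0 < u ∧ (x : P1) = (gk q k)⁻¹ • (u : P1) := by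
  have hs := sin_angle_pos hq
  obtain ⟨θ, hθ⟩ : ∃ θ, θ = Real.pi / q := ⟨_, rfl⟩
  -- The index `q - 1` qualifies because `sin π = 0`, which makes its lower endpoint `0`.
  have hlast : 0 < Real.sin ((q - 1 : ℕ) * θ) * x - Real.sin (((q - 1 : ℕ) + 1) * θ) := by
    have hq0 : (q : ℝ) ≠ 0 := by positivity
    have e1 : (q : ℝ) * θ = Real.pi := by rw [hθ]; field_simp
    rw [Nat.cast_sub (by omega), Nat.cast_one, sub_add_cancel, e1, Real.sin_pi, sub_mul, e1,
      one_mul, Real.sin_pi_sub, sub_zero]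
    rw [hθ]; exact mul_pos hs hx
  classical
  have hex : ∃ k : ℕ, 0 < Real.sin (k * θ) * x - Real.sin ((k + 1) * θ) := ⟨_, hlast⟩
  have hk0 := Nat.find_spec hex
  have hkle := Nat.find_le (h := hex) hlast
  have hkmin := fun m => Nat.find_min (m := m) hex
  generalize Nat.find hex = k at hk0 hkle hkmin
  have hk1 : 1 ≤ k := by
    rw [Nat.one_le_iff_ne_zero]
    rintro rfl
    simp [hθ] at hk0
    linarith
  refine ⟨k, ⟨hk1, hkle⟩, ?_⟩
  obtain ⟨A, hA, hA1, hA2, hA3, hA4⟩ := T_mul_S_pow q k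
  have hdom := (dominatesOne_of_sin hq hk1 hkle hA1 hA2 hA3 hA4).1
  rw [← gk_inv] at hA
  have hprev := hkmin (k - 1) (by omega)
  rw [Nat.cast_sub hk1, Nat.cast_one, sub_add_cancel, not_lt, hθ, ← hA3, ← hA1, mul_assoc,
    ← mul_sub] at hprev
  rw [hθ, ← hA2, ← hA4, mul_assoc, ← mul_sub] at hk0
  have hlow : 0 < A 1 1 * x - A 0 1 := pos_of_mul_pos_right hk0 hs.le
  have hup : A 1 0 * x - A 0 0 ≤ 0 := nonpos_of_mul_nonpos_right hprev hs
  have hd : 0 < A 1 1 := by linarith [hdom.one_le_d]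
  rw [hA, ← hdom.mem_interval_iff]
  constructor
  · rw [toG_smul_coe, if_neg (by simpa using hd.ne'), P1Lt_coe_coe, mul_zero, mul_zero, zero_add,
      zero_add, div_lt_iff₀ hd]
    linarith
  · have hne := h k
    rw [hA, toG_smul_infty] at hne
    rw [toG_smul_infty]
    split_ifs at hne ⊢ with h0
    · exact P1Lt_coe_infty x
    · have hc : 0 < A 1 0 := lt_of_le_of_ne hdom.c_nonneg (Ne.symm h0)
      rw [Ne, OnePoint.coe_eq_coe] at hne
      refine P1Lt_coe_coe.2 (lt_of_le_of_ne ?_ (Ne.symm hne))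
      rw [le_div_iff₀ hc]
      linarith

/-- `c` is fixed by a nontrivial element of the Hecke triangle group. -/
def GeoClass.IsClosed (q : ℕ) (c : GeoClass) : Prop := ∃ g ∈ Gam q, g ≠ 1 ∧ g • c = c

lemma GeoClass.IsClosed.smul {q : ℕ} {c : GeoClass} (h : c.IsClosed q) {a : G} (ha : a ∈ Gam q) :
    (a • c).IsClosed q := by
  obtain ⟨g, hg, hg1, hgc⟩ := h
  refine ⟨a * g * a⁻¹, mul_mem (mul_mem ha hg) (inv_mem ha), ?_, ?_⟩
  · rwa [Ne, conj_eq_one_iff]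
  · rw [mul_smul, mul_smul, inv_smul_smul, hgc]

lemma T_inv_pow_smul_coe (q n : ℕ) (y : ℝ) : ((T q)⁻¹ ^ n) • (y : P1) =
    ((y - n * (2 * Real.cos (Real.pi / q)) : ℝ) : P1) := by
  induction n with
  | zero => simp
  | succ n ih =>
    rw [pow_succ', mul_smul, ih, inv_smul_eq_iff, T, toG_smul_coe, if_neg (by simp [coe_matT])]
    congr 1
    simp [coe_matT]
    ring

lemma T_inv_pow_smul_infty (q n : ℕ) :
    ((T q)⁻¹ ^ n) • (OnePoint.infty : P1) = OnePoint.infty := by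
  induction n with
  | zero => simp
  | succ n ih =>
    rw [pow_succ', mul_smul, ih, inv_smul_eq_iff, T, toG_smul_infty, if_pos (by simp [coe_matT])]

/-- A closed geodesic does not run into the cusp. -/
lemma GeoClass.IsClosed.ne_infty {q : ℕ} (hq : 3 ≤ q) {c : GeoClass} (h : c.IsClosed q) {x y : P1}
    (he : c.HasEnds x y) : x ≠ OnePoint.infty := by
  rintro rfl
  have hy := he.ne
  induction y using OnePoint.rec with
  | infty => exact hy rfl
  | coe y =>
    have hc := cos_angle_pos hq
    obtain ⟨n, hn⟩ := exists_nat_gt (y / (2 * Real.cos (Real.pi / q)))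
    rw [div_lt_iff₀ (by positivity)] at hn
    -- A power of `T q` fixes `∞` and pushes the other end below `0`, so the translated class is
    -- reduced and its stabilizer consists of words and their inverses.
    have he' := he.smul ((T q)⁻¹ ^ n)
    rw [T_inv_pow_smul_coe, T_inv_pow_smul_infty] at he'
    have hT : T q ∈ Gam q := Subgroup.subset_closure (by simp)
    obtain ⟨g, hg, hg1, hgc⟩ := h.smul (pow_mem (inv_mem hT) n)
    generalize ((T q)⁻¹ ^ n) • c = d at he' hgc
    have hd : d.IsReduced := ⟨_, _, he', P1Lt_coe_infty 0, P1Lt_coe_coe.2 (by linarith)⟩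
    obtain ⟨l, hl, hgl⟩ := exists_wordProd_of_isReduced hq hg hd (hgc.symm ▸ hd)
    have hl0 : l ≠ [] := by
      rintro rfl
      simp [wordProd_nil] at hgl
      exact hg1 hgl
    have hlc : wordProd q l • d = d := by
      rcases hgl with rfl | rfl
      · exact hgc
      · rwa [inv_smul_eq_iff, eq_comm] at hgc
    obtain ⟨A, hA, hA1, hA2⟩ := wordProd_matrix hq hl
    have hA2 := hA2 hl0
    have hends := (he'.smul (wordProd q l)).unique (hlc.symm ▸ he')
    have hdet := det_eq_one A
    rw [hA, toG_smul_infty, toG_smul_coe] at hends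
    have hc0 : A 1 0 = 0 := by
      by_contra h0
      rw [if_neg h0] at hends
      exact OnePoint.coe_ne_infty _ hends.1
    -- Fixing `∞` gives `a * d = 1` with `a, d ≥ 1`, so the word is a translation. Having a finite
    -- fixed point, it has `b = 0`, against the positive off-diagonal sum.
    have ha : A 0 0 = 1 := by nlinarith [hA1.one_le_a, hA1.one_le_d]
    have hd : A 1 1 = 1 := by nlinarith [hA1.one_le_a, hA1.one_le_d]
    have this := hends.2
    rw [hc0, ha, hd, if_neg (by simp), OnePoint.coe_eq_coe] at this
    simp at this
    rw [this, hc0] at hA2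
    simp at hA2

lemma exists_isIntervalIndex {q : ℕ} (hq : 3 ≤ q) {c : GeoClass} (hc : c.IsReduced)
    (hcl : c.IsClosed q) : ∃ k, IsIntervalIndex q c k := by
  obtain ⟨x, y, he, hx, -⟩ := hc
  have hxi := hcl.ne_infty hq he
  induction x using OnePoint.rec with
  | infty => exact absurd rfl hxi
  | coe x =>
    -- If `c` ended at `g_k⁻¹.∞`, the closed class `g_k.c` would end at `∞`.
    obtain ⟨k, hk, u, hu, hxu⟩ := exists_eq_gk_inv_smul hq (P1Lt_coe_coe.1 hx) fun k hk =>
      (hcl.smul (gk_mem q k)).ne_infty hq (he.smul (gk q k)) (by rw [← hk, smul_inv_smul])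
    exact ⟨k, (isIntervalIndex_iff hq).2 ⟨hk, u, y, hu, hxu ▸ he⟩⟩

lemma IsIntervalIndex.isReduced_smul {q : ℕ} (hq : 3 ≤ q) {c : GeoClass} {k : ℕ}
    (hk : IsIntervalIndex q c k) (hc : c.IsReduced) : (gk q k • c).IsReduced := by
  obtain ⟨hk, u, y, hu, he⟩ := (isIntervalIndex_iff hq).1 hk
  obtain ⟨x', y', he', -, hy⟩ := hc
  obtain ⟨rfl, rfl⟩ := he.unique he'
  have h := he.smul (gk q k)
  rw [smul_inv_smul] at h
  refine ⟨_, _, h, P1Lt_coe_coe.2 hu, ?_⟩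
  have := neg_wordProd_inv_smul hq (l := [k]) (by simpa [IsWord] using hk) hy
  rwa [wordProd_cons, wordProd_nil, mul_one, inv_inv] at this

/-! ### The reduction map on classes of geodesics -/

/-- The index `k` of the interval that contains `c(+∞)`. -/
def idx (q : ℕ) (c : GeoClass) : ℕ := Classical.epsilon (IsIntervalIndex q c)

/-- The reduction map `c ↦ g_k.c`. -/
def step (q : ℕ) (c : GeoClass) : GeoClass := gk q (idx q c) • c

/-- The sequence of the indices along the orbit of `c`, starting at `1`. -/
def idxSeq (q : ℕ) (c : GeoClass) (i : ℕ) : ℕ := idx q ((step q)^[i - 1] c)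

lemma idx_spec {q : ℕ} (hq : 3 ≤ q) {c : GeoClass} (hc : c.IsReduced) (hcl : c.IsClosed q) :
    IsIntervalIndex q c (idx q c) :=
  Classical.epsilon_spec (exists_isIntervalIndex hq hc hcl)

lemma step_isReduced {q : ℕ} (hq : 3 ≤ q) {c : GeoClass} (hc : c.IsReduced) (hcl : c.IsClosed q) :
    (step q c).IsReduced :=
  (idx_spec hq hc hcl).isReduced_smul hq hc

lemma step_isClosed {q : ℕ} {c : GeoClass} (hcl : c.IsClosed q) : (step q c).IsClosed q :=
  hcl.smul (gk_mem q _)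

lemma iterate_step_isClosed {q : ℕ} {c : GeoClass} (hcl : c.IsClosed q) (i : ℕ) :
    ((step q)^[i] c).IsClosed q := by
  induction i with
  | zero => exact hcl
  | succ i ih => rw [Function.iterate_succ_apply']; exact step_isClosed ih

lemma iterate_step_isReduced {q : ℕ} (hq : 3 ≤ q) {c : GeoClass} (hc : c.IsReduced)
    (hcl : c.IsClosed q) (i : ℕ) : ((step q)^[i] c).IsReduced := by
  induction i with
  | zero => exact hc
  | succ i ih =>
    rw [Function.iterate_succ_apply']
    exact step_isReduced hq ih (iterate_step_isClosed hcl i)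

lemma periodProd_zero (q : ℕ) (k : ℕ → ℕ) : periodProd q k 0 = 1 := rfl

lemma periodProd_add (q : ℕ) (k : ℕ → ℕ) (m n : ℕ) :
    periodProd q k (m + n) = periodProd q k m * periodProd q (fun i => k (m + i)) n := by
  rw [periodProd, List.range_add, List.map_append, List.prod_append, List.map_map]
  rfl

lemma periodProd_one (q : ℕ) (k : ℕ → ℕ) : periodProd q k 1 = (gk q (k 1))⁻¹ := by
  simp [periodProd]

lemma periodProd_succ (q : ℕ) (k : ℕ → ℕ) (n : ℕ) :
    periodProd q k (n + 1) = periodProd q k n * (gk q (k (n + 1)))⁻¹ := by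
  rw [periodProd_add, periodProd_one]

lemma periodProd_congr {q : ℕ} {k k' : ℕ → ℕ} (h : ∀ i, k (i + 1) = k' (i + 1)) (n : ℕ) :
    periodProd q k n = periodProd q k' n := by
  simp [periodProd, h]

lemma periodProd_mem (q : ℕ) (k : ℕ → ℕ) (n : ℕ) : periodProd q k n ∈ Gam q := by
  induction n with
  | zero => exact one_mem _
  | succ n ih => rw [periodProd_succ]; exact mul_mem ih (inv_mem (gk_mem q _))

lemma periodProd_idxSeq_add (q : ℕ) (c : GeoClass) (m n : ℕ) :
    periodProd q (idxSeq q c) (m + n) =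
      periodProd q (idxSeq q c) m * periodProd q (idxSeq q ((step q)^[m] c)) n := by
  rw [periodProd_add]
  refine congrArg (periodProd q (idxSeq q c) m * ·) (periodProd_congr (fun i => ?_) n)
  rw [idxSeq, idxSeq, ← add_assoc, Nat.add_sub_cancel, Nat.add_sub_cancel, add_comm,
    Function.iterate_add_apply]

lemma periodProd_smul_iterate_step (q : ℕ) (c : GeoClass) (n : ℕ) :
    periodProd q (idxSeq q c) n • (step q)^[n] c = c := by
  induction n with
  | zero => exact one_smul G c
  | succ n ih =>
    rw [periodProd_succ, Function.iterate_succ_apply', mul_smul, step, idxSeq, Nat.add_sub_cancel,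
      inv_smul_smul, ih]

lemma periodProd_mul_of_iterate_eq {q : ℕ} {c : GeoClass} {n : ℕ} (h : (step q)^[n] c = c)
    (j : ℕ) : periodProd q (idxSeq q c) (n * j) = periodProd q (idxSeq q c) n ^ j := by
  induction j with
  | zero => exact (pow_zero _).symm
  | succ j ih => rw [Nat.mul_succ, add_comm, periodProd_idxSeq_add, h, ih, pow_succ']

lemma isWord_map_idxSeq {q : ℕ} (hq : 3 ≤ q) {c : GeoClass} (hc : c.IsReduced)
    (hcl : c.IsClosed q) (n : ℕ) :
    IsWord q ((List.range n).map fun i => idxSeq q c (i + 1)) := by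
  intro k hk
  obtain ⟨i, -, rfl⟩ := List.mem_map.1 hk
  exact ((isIntervalIndex_iff hq).1
    (idx_spec hq (iterate_step_isReduced hq hc hcl i) (iterate_step_isClosed hcl i))).1

lemma periodProd_eq_wordProd (q : ℕ) (k : ℕ → ℕ) (n : ℕ) :
    periodProd q k n = wordProd q ((List.range n).map fun i => k (i + 1)) := by
  rw [periodProd, wordProd, List.map_map]; rfl

/-- Let `k` be the first letter and `w'` the remaining word. The class `g_k.c` ends at the image
under `w'` of a positive point, which is positive, and finite by closedness. So `k` is forced to be
the interval index of `c`; induct on `w'`. -/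
lemma wordProd_inv_smul_eq_iterate_step {q : ℕ} (hq : 3 ≤ q) {l : List ℕ} (hl : IsWord q l)
    {c : GeoClass} (hc : c.IsReduced) (hcl : c.IsClosed q)
    (hd : ((wordProd q l)⁻¹ • c).IsReduced) :
    (step q)^[l.length] c = (wordProd q l)⁻¹ • c ∧
      wordProd q l = periodProd q (idxSeq q c) l.length := by
  induction l generalizing c with
  | nil => exact ⟨by simp [wordProd_nil], by rw [wordProd_nil, List.length_nil, periodProd_zero]⟩
  | cons k l ih =>
    rw [isWord_cons] at hl
    have hmem := gk_mem q k
    rw [wordProd_cons, mul_inv_rev, inv_inv, mul_smul] at hd ⊢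
    have hk : IsIntervalIndex q c k := by
      obtain ⟨x, y, he, hx, -⟩ := hd
      have he1 := he.smul (wordProd q l)
      rw [smul_inv_smul] at he1
      have hpos := pos_wordProd_smul hq hl.2 hx
      have hinf := (hcl.smul hmem).ne_infty hq he1
      generalize wordProd q l • x = u at he1 hpos hinf
      induction u using OnePoint.rec with
      | infty => exact absurd rfl hinf
      | coe u =>
        refine (isIntervalIndex_iff hq).2 ⟨hl.1, u, (gk q k)⁻¹ • wordProd q l • y,
          P1Lt_coe_coe.1 hpos, ?_⟩
        simpa using he1.smul (gk q k)⁻¹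
    have hidx : idx q c = k := (idx_spec hq hc hcl).unique hq hk
    have hstep : step q c = gk q k • c := by rw [step, hidx]
    obtain ⟨h1, h2⟩ := ih hl.2 (hk.isReduced_smul hq hc) (hcl.smul hmem) hd
    refine ⟨by rw [List.length_cons, Function.iterate_succ_apply, hstep, h1], ?_⟩
    rw [List.length_cons, add_comm, periodProd_idxSeq_add, periodProd_one, h2, idxSeq,
      Function.iterate_one, hstep, Nat.sub_self, Function.iterate_zero_apply, hidx]

lemma iterate_step_eq_of_wordProd_smul_eq {q : ℕ} (hq : 3 ≤ q) {l : List ℕ} (hl : IsWord q l)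
    {c : GeoClass} (hc : c.IsReduced) (hcl : c.IsClosed q) (h : wordProd q l • c = c) :
    (step q)^[l.length] c = c ∧ wordProd q l = periodProd q (idxSeq q c) l.length := by
  have h' : (wordProd q l)⁻¹ • c = c := by rw [inv_smul_eq_iff, h]
  have := wordProd_inv_smul_eq_iterate_step hq hl hc hcl (h'.symm ▸ hc)
  rwa [h'] at this

lemma exists_wordProd_smul_eq {q : ℕ} (hq : 3 ≤ q) {c : GeoClass} (hc : c.IsReduced)
    {g : G} (hg : g ∈ Gam q) (hgc : g • c = c) :
    ∃ l, IsWord q l ∧ wordProd q l • c = c ∧ (g = wordProd q l ∨ g = (wordProd q l)⁻¹) := by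
  obtain ⟨l, hl, h⟩ := exists_wordProd_of_isReduced hq hg hc (hgc.symm ▸ hc)
  refine ⟨l, hl, ?_, h⟩
  rcases h with rfl | rfl
  · exact hgc
  · rwa [inv_smul_eq_iff, eq_comm] at hgc

lemma exists_iterate_step_eq {q : ℕ} (hq : 3 ≤ q) {c : GeoClass} (hc : c.IsReduced)
    (hcl : c.IsClosed q) : ∃ n, 1 ≤ n ∧ (step q)^[n] c = c := by
  obtain ⟨g, hg, hg1, hgc⟩ := id hcl
  obtain ⟨l, hl, hlc, h⟩ := exists_wordProd_smul_eq hq hc hg hgc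
  refine ⟨l.length, ?_, (iterate_step_eq_of_wordProd_smul_eq hq hl hc hcl hlc).1⟩
  rw [Nat.one_le_iff_ne_zero, Ne, List.length_eq_zero_iff]
  rintro rfl
  simp [wordProd_nil] at h
  exact hg1 h

/-- Every reduced translate of `c` lies on the orbit of `c` under the reduction map. -/
lemma exists_iterate_step_eq_smul {q : ℕ} (hq : 3 ≤ q) {c : GeoClass} (hc : c.IsReduced)
    (hcl : c.IsClosed q) {g : G} (hg : g ∈ Gam q) (hgc : (g • c).IsReduced) :
    ∃ i, (step q)^[i] c = g • c := by
  obtain ⟨l, hl, rfl | rfl⟩ := exists_wordProd_of_isReduced hq hg hc hgc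
  · have hd := hcl.smul hg
    generalize hdc : wordProd q l • c = d at hgc hd
    have hcd : c = (wordProd q l)⁻¹ • d := by rw [← hdc, inv_smul_smul]
    have h1 := (wordProd_inv_smul_eq_iterate_step hq hl hgc hd (hcd ▸ hc)).1
    rw [← hcd] at h1
    obtain ⟨n, hn, h2⟩ := exists_iterate_step_eq hq hgc hd
    have h3 : (step q)^[n * l.length] d = d := by
      rw [Function.iterate_mul]; exact Function.iterate_fixed h2 _
    -- Here `c` lies `l.length` steps after `d` on the cycle of `d`. Completing `l.length` turns of
    -- length `n` leads from `c` back to `d`.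
    refine ⟨n * l.length - l.length, ?_⟩
    rw [← h1, ← Function.iterate_add_apply, Nat.sub_add_cancel (Nat.le_mul_of_pos_left _ hn), h3]
  · exact ⟨_, (wordProd_inv_smul_eq_iterate_step hq hl hc hcl hgc).1⟩

/-- The stabilizer of `c` is generated by the product over a period. -/
lemma eq_periodProd_pow_of_smul_eq {q : ℕ} (hq : 3 ≤ q) {c : GeoClass} (hc : c.IsReduced)
    (hcl : c.IsClosed q) {g : G} (hg : g ∈ Gam q) (hgc : g • c = c) :
    ∃ j : ℕ, g = periodProd q (idxSeq q c) (Function.minimalPeriod (step q) c) ^ j ∨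
      g = (periodProd q (idxSeq q c) (Function.minimalPeriod (step q) c) ^ j)⁻¹ := by
  obtain ⟨l, hl, hlc, h⟩ := exists_wordProd_smul_eq hq hc hg hgc
  obtain ⟨h1, h2⟩ := iterate_step_eq_of_wordProd_smul_eq hq hl hc hcl hlc
  -- The word length is a period of `step`, hence a multiple of the minimal one.
  obtain ⟨j, hj⟩ := Function.IsPeriodicPt.minimalPeriod_dvd h1
  rw [hj, periodProd_mul_of_iterate_eq (Function.iterate_minimalPeriod)] at h2
  exact ⟨j, h2 ▸ h⟩

/-! ### Translation lengths -/

lemma UGeo.shift_injective (γ : UGeo) : Function.Injective γ.shift := by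
  intro s t h
  have h0 : γ (0 + s) = γ (0 + t) := congrFun (congrArg UGeo.toFun h) 0
  simpa using γ.isometry.injective h0

/-- This detects the direction of translation: iterates of `i` under a word cannot converge to a
negative number. -/
lemma DominatesOne.re_smul_nonneg {A : SL(2, ℝ)} (hA : DominatesOne A) {z : ℍ} (hz : 0 ≤ z.re) :
    0 ≤ (toG A • z).re := by
  obtain ⟨a1, a2, a3, a4⟩ := hA
  change 0 ≤ ((toG A • z : ℍ) : ℂ).re
  rw [coe_toG_smul, Complex.div_re, ← add_div]
  apply div_nonneg _ (Complex.normSq_nonneg _)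
  have hz' : 0 ≤ (z : ℂ).re := hz
  have ha : 0 ≤ A 0 0 := zero_le_one.trans a1
  have hd : 0 ≤ A 1 1 := zero_le_one.trans a2
  have : 0 ≤ (A 0 0 * (z : ℂ).re + A 0 1) * (A 1 0 * (z : ℂ).re + A 1 1) +
      A 0 0 * A 1 0 * ((z : ℂ).im * (z : ℂ).im) := by
    have := mul_self_nonneg (z : ℂ).im
    positivity
  simp only [UpperHalfPlane.coe_re, UpperHalfPlane.coe_im] at this
  simp
  linarith

/-- A nonempty word that fixes `c` translates `c` in the positive direction. -/
lemma exists_shift_of_wordProd_smul_eq {q : ℕ} (hq : 3 ≤ q) {l : List ℕ} (hl : IsWord q l)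
    (hl0 : l ≠ []) {γ : UGeo} (hc : (GeoClass.mk γ).IsReduced)
    (h : wordProd q l • GeoClass.mk γ = GeoClass.mk γ) :
    ∃ t, 0 < t ∧ wordProd q l • γ = γ.shift t := by
  rw [GeoClass.smul_mk, eq_comm] at h
  obtain ⟨t, ht⟩ := mk_eq_mk_iff.1 h
  refine ⟨t, ?_, ht⟩
  obtain ⟨A, hA, hA1, hA2⟩ := wordProd_matrix hq hl
  by_contra! hneg
  rcases hneg.eq_or_lt with rfl | hneg
  · rw [UGeo.shift_zero] at ht
    have h1 := UGeo.eq_one_of_smul_eq ht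
    rw [hA] at h1
    have h2 : A = 1 ∨ A = -1 :=
      eq_one_or_neg_one_of_mem_center ((QuotientGroup.eq_one_iff A).1 h1)
    have h3 := hA2 hl0
    rcases h2 with rfl | rfl <;> simp at h3
  -- A backward shift would make the negative endpoint attracting for the word, whereas its iterates
  -- of `i` keep a nonnegative real part.
  · have h1 : (wordProd q l)⁻¹ • γ = γ.shift (-t) := by
      rw [inv_smul_eq_iff, UGeo.smul_shift, ht, UGeo.shift_shift, add_neg_cancel, UGeo.shift_zero]
    obtain ⟨x, y, he, hx, hy⟩ := hc
    have h2 := (UGeo.hasFixedPair_of_smul_eq_shift (neg_pos.2 hneg) h1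
      (GeoClass.hasEnds_mk.1 he)).2.2.2 UpperHalfPlane.I
    obtain ⟨y, rfl⟩ := hy.exists_coe
    rw [P1Lt_coe_coe] at hy
    have h3 := h2.2
    rw [inv_inv, tendsToBoundary_coe] at h3
    have h4 : ∀ n : ℕ, 0 ≤ (wordProd q l ^ n • UpperHalfPlane.I).re := by
      intro n
      induction n with
      | zero => simp
      | succ n ih => rw [pow_succ', mul_smul, hA]; rw [hA] at ih; exact hA1.re_smul_nonneg ih
    have h5 := (Complex.continuous_re.tendsto _).comp h3
    have h6 : 0 ≤ y := ge_of_tendsto' h5 h4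
    linarith

/-- The sequence `a.g^n.z = g^n.(a.z)` tends both to `a.x` and to `x`; the same holds for `g⁻¹` and
`y`. -/
lemma HasFixedPair.smul_eq_of_commute {g a : G} {x y : P1} (h : HasFixedPair g x y)
    (ha : Commute a g) : a • x = x ∧ a • y = y := by
  obtain ⟨-, -, -, h⟩ := h
  have h1 := h UpperHalfPlane.I
  have h2 := h (a • UpperHalfPlane.I)
  constructor
  · refine (h1.1.smul a).unique ?_
    simpa only [← mul_smul, (ha.pow_right _).eq] using h2.1
  · refine (h1.2.smul a).unique ?_
    simpa only [← mul_smul, (ha.inv_right.pow_right _).eq] using h2.2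

/-! ### Levels of hyperbolic elements -/

lemma UGeo.inv_smul_eq_shift {g : G} {γ : UGeo} {s : ℝ} (h : g • γ = γ.shift s) :
    g⁻¹ • γ = γ.shift (-s) := by
  rw [inv_smul_eq_iff, UGeo.smul_shift, h, UGeo.shift_shift, add_neg_cancel, UGeo.shift_zero]

lemma HasFixedPair.shift_pos {g : G} {γ : UGeo} {x y : P1} {s : ℝ} (h : HasFixedPair g x y)
    (he : γ.HasEnds x y) (hs : g • γ = γ.shift s) : 0 < s := by
  have hxy : x ≠ y := (GeoClass.hasEnds_mk.2 he).ne
  obtain ⟨h1, h2⟩ := h.2.2.2 UpperHalfPlane.I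
  by_contra! hneg
  rcases hneg.eq_or_lt with rfl | hneg
  · rw [UGeo.shift_zero] at hs
    obtain rfl := UGeo.eq_one_of_smul_eq hs
    rw [inv_one] at h2
    exact hxy (h1.unique h2)
  · have h3 := UGeo.hasFixedPair_of_smul_eq_shift (neg_pos.2 hneg) (UGeo.inv_smul_eq_shift hs) he
    exact hxy ((h3.2.2.2 UpperHalfPlane.I).1.unique h2)

lemma GeoClass.smul_eq_of_hasEnds {c : GeoClass} {x y : P1} (he : c.HasEnds x y) {a : G}
    (hx : a • x = x) (hy : a • y = y) : a • c = c := by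
  have := he.smul a
  rw [hx, hy] at this
  exact GeoClass.eq_of_hasEnds this he

/-- An `m`-th root of `h ^ j` commutes with it, so it fixes both endpoints and is a power of `h` or
the inverse of one. Comparing shifts rules out inverses and gives `j = m * i` with `i ≥ 1`, hence `m
≤ j`. -/
lemma pow_mem_GamLevel {q : ℕ} {γ : UGeo} {h : G} {t : ℝ} (hmem : h ∈ Gam q) (ht : 0 < t)
    (hh : h • γ = γ.shift t)
    (hstab : ∀ a ∈ Gam q, a • GeoClass.mk γ = GeoClass.mk γ → ∃ j : ℕ, a = h ^ j ∨ a = (h ^ j)⁻¹)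
    {j : ℕ} (hj : 1 ≤ j) : h ^ j ∈ GamLevel q j := by
  have hj0 : (0 : ℝ) < j := by exact_mod_cast hj
  obtain ⟨x, y, -, he⟩ := γ.exists_hasEnds
  have hjs := UGeo.pow_smul_eq_shift hh j
  have hfix := UGeo.hasFixedPair_of_smul_eq_shift (mul_pos hj0 ht) hjs he
  refine ⟨pow_mem hmem j, hfix.1, ⟨hj, h, hmem, rfl⟩, ?_⟩
  rintro m ⟨hm, a, ha, hja⟩
  have hcomm : Commute a (h ^ j) := hja ▸ Commute.self_pow a m
  obtain ⟨hx, hy⟩ := hfix.smul_eq_of_commute hcomm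
  obtain ⟨i, hi⟩ := hstab a ha (GeoClass.smul_eq_of_hasEnds (GeoClass.hasEnds_mk.2 he) hx hy)
  have his := UGeo.pow_smul_eq_shift hh i
  rcases hi with rfl | rfl
  · have h1 := UGeo.pow_smul_eq_shift his m
    rw [← hja, hjs] at h1
    have h2 := γ.shift_injective h1
    rw [← mul_assoc] at h2
    have h3 : j = m * i := by exact_mod_cast mul_right_cancel₀ ht.ne' h2
    rw [h3]
    exact Nat.le_mul_of_pos_right _ (Nat.pos_of_ne_zero (by rintro rfl; omega))
  · have h1 := UGeo.pow_smul_eq_shift (UGeo.inv_smul_eq_shift his) m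
    rw [← hja, hjs] at h1
    have h2 := γ.shift_injective h1
    have h3 : 0 ≤ (m : ℝ) * (i * t) := by positivity
    nlinarith [mul_pos hj0 ht]

lemma setOf_mem_GamLevel_eq {q : ℕ} {γ : UGeo} {h : G} {t : ℝ} (hmem : h ∈ Gam q) (ht : 0 < t)
    (hh : h • γ = γ.shift t)
    (hstab : ∀ a ∈ Gam q, a • GeoClass.mk γ = GeoClass.mk γ → ∃ j : ℕ, a = h ^ j ∨ a = (h ^ j)⁻¹)
    {x y : P1} (he : γ.HasEnds x y) {m : ℕ} (hm : 1 ≤ m) :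
    {g : G | g ∈ GamLevel q m ∧ HasFixedPair g x y} = {h ^ m} := by
  have hm0 : (0 : ℝ) < m := by exact_mod_cast hm
  ext g
  rw [Set.mem_singleton_iff]
  constructor
  · rintro ⟨hg, hfix⟩
    obtain ⟨j, hj⟩ := hstab g hg.1
      (GeoClass.smul_eq_of_hasEnds (GeoClass.hasEnds_mk.2 he) hfix.2.1 hfix.2.2.1)
    have hjs := UGeo.pow_smul_eq_shift hh j
    rcases hj with rfl | rfl
    · have h1 := hfix.shift_pos he hjs
      have h2 : 1 ≤ j := by
        rw [Nat.one_le_iff_ne_zero]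
        rintro rfl
        simp at h1
      -- The exponent is the level, and the level is unique.
      rw [hg.2.2.unique (pow_mem_GamLevel hmem ht hh hstab h2).2.2]
    · have h1 := hfix.shift_pos he (UGeo.inv_smul_eq_shift hjs)
      have h2 : 0 ≤ (j : ℝ) * t := by positivity
      linarith
  · rintro rfl
    exact ⟨pow_mem_GamLevel hmem ht hh hstab hm,
      UGeo.hasFixedPair_of_smul_eq_shift (mul_pos hm0 ht) (UGeo.pow_smul_eq_shift hh m) he⟩

end HeckeReduction

end

/-! ### The main theorem -/

open HeckeReduction in
theorem mainTheorem6 (q : ℕ) (hq : 3 ≤ q) (ch : HeckeReduction.PGeoClass q)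
    (c₀ : HeckeReduction.GeoClass) (hc₀ : HeckeReduction.IsReducedLift ch c₀) :
    ∃ (k : ℕ → ℕ) (c : ℕ → HeckeReduction.GeoClass),
      -- the sequence `c i = [γ_i]`, each step being possible in exactly one way
      c 0 = c₀ ∧
      (∀ i : ℕ, 1 ≤ i →
        HeckeReduction.IsIntervalIndex q (c (i - 1)) (k i) ∧
        (∀ j : ℕ, HeckeReduction.IsIntervalIndex q (c (i - 1)) j → j = k i) ∧
        c i = HeckeReduction.gk q (k i) • c (i - 1)) ∧
      -- it returns to `[γ_0]`, for the first time after `n ≥ 1` steps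
      ∃ n : ℕ, IsLeast {m : ℕ | 1 ≤ m ∧ c m = c 0} n ∧
        -- `[γ_0], …, [γ_{n-1}]` are pairwise distinct and are all the reduced lifts
        Set.InjOn c (Set.Iio n) ∧
        c '' Set.Iio n = {d : HeckeReduction.GeoClass | HeckeReduction.IsReducedLift ch d} ∧
        -- the hyperbolic elements attached to the endpoints `x = γ_0(+∞)`, `y = γ_0(-∞)`
        ∃ (x y : HeckeReduction.P1) (t : ℝ), c₀.HasEnds x y ∧
          HeckeReduction.IsPrimitiveHyperbolic q (HeckeReduction.periodProd q k n) ∧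
          HeckeReduction.HasFixedPair (HeckeReduction.periodProd q k n) x y ∧
          HeckeReduction.HasDisplacement (HeckeReduction.periodProd q k n) t ∧
          ∀ m : ℕ, 1 ≤ m →
            {g : HeckeReduction.G | g ∈ HeckeReduction.GamLevel q m ∧
              HeckeReduction.HasFixedPair g x y} =
              {HeckeReduction.periodProd q k n ^ m} ∧
            {g : HeckeReduction.G | g ∈ HeckeReduction.GamLevel q m ∧
              HeckeReduction.HasFixedPair g x y ∧
              HeckeReduction.HasDisplacement g (m * t)} =
              {HeckeReduction.periodProd q k n ^ m} := by
  obtain ⟨g₀, hg₀⟩ := hc₀.exists_smul_eq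
  have hcl : c₀.IsClosed q := ⟨g₀, hg₀⟩
  have hc := hc₀.isReduced
  set n := Function.minimalPeriod (step q) c₀ with hn
  have hn1 : 1 ≤ n := by
    obtain ⟨m, hm, h⟩ := exists_iterate_step_eq hq hc hcl
    exact Function.IsPeriodicPt.minimalPeriod_pos hm h
  have hper : (step q)^[n] c₀ = c₀ := Function.iterate_minimalPeriod
  refine ⟨idxSeq q c₀, fun i => (step q)^[i] c₀, rfl, ?_, n, ⟨⟨hn1, hper⟩, ?_⟩, ?_, ?_, ?_⟩
  · intro i hi
    have hred := iterate_step_isReduced hq hc hcl (i - 1)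
    have hclo := iterate_step_isClosed hcl (i - 1)
    have hidx := idx_spec hq hred hclo
    refine ⟨hidx, fun j hj => hj.unique hq hidx, ?_⟩
    obtain ⟨i, rfl⟩ := Nat.exists_eq_add_of_le' hi
    exact Function.iterate_succ_apply' _ _ _
  · rintro m ⟨hm, h⟩
    exact Function.IsPeriodicPt.minimalPeriod_le hm h
  · exact Function.iterate_injOn_Iio_minimalPeriod
  · ext d
    simp only [Set.mem_image, Set.mem_Iio, Set.mem_ofPred_eq]
    rw [isReducedLift_iff hc₀]
    constructor
    · rintro ⟨i, -, rfl⟩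
      refine ⟨⟨(periodProd q (idxSeq q c₀) i)⁻¹, inv_mem (periodProd_mem q _ i), ?_⟩,
        iterate_step_isReduced hq hc hcl i⟩
      rw [eq_inv_smul_iff, periodProd_smul_iterate_step]
    · rintro ⟨⟨g, hg, rfl⟩, hr⟩
      obtain ⟨i, hi⟩ := exists_iterate_step_eq_smul hq hc hcl hg hr
      -- The orbit is periodic, so any iterate can be moved into the first period.
      exact ⟨i % n, Nat.mod_lt _ hn1, by rw [Function.iterate_mod_minimalPeriod_eq, hi]⟩
  · obtain ⟨x, y, he, -⟩ := id hc
    obtain ⟨γ, rfl, heγ⟩ := id he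
    have hmem := periodProd_mem q (idxSeq q (GeoClass.mk γ)) n
    have hstab := fun a ha h => eq_periodProd_pow_of_smul_eq hq hc hcl (g := a) ha h
    have hfix := periodProd_smul_iterate_step q (GeoClass.mk γ) n
    rw [hper] at hfix
    obtain ⟨t, ht, hh⟩ : ∃ t, 0 < t ∧ periodProd q (idxSeq q (GeoClass.mk γ)) n • γ = γ.shift t := by
      rw [periodProd_eq_wordProd] at hfix ⊢
      refine exists_shift_of_wordProd_smul_eq hq (isWord_map_idxSeq hq hc hcl n) ?_ hc hfix
      simp only [ne_eq, List.map_eq_nil_iff, List.range_eq_nil]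
      omega
    refine ⟨x, y, t, he, ?_, UGeo.hasFixedPair_of_smul_eq_shift ht hh heγ,
      UGeo.hasDisplacement_of_smul_eq_shift ht hh, fun m hm => ?_⟩
    · have := pow_mem_GamLevel hmem ht hh hstab le_rfl
      rwa [pow_one] at this
    · have hset := setOf_mem_GamLevel_eq hmem ht hh hstab heγ hm
      -- The second set lies in the first, so only the displacement `m * t` of `h ^ m` is new.
      refine ⟨hset, ?_⟩
      have hm0 : (0 : ℝ) < m := by exact_mod_cast hm
      have hdisp := UGeo.hasDisplacement_of_smul_eq_shift (mul_pos hm0 ht)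
        (UGeo.pow_smul_eq_shift hh m)
      rw [Set.eq_singleton_iff_unique_mem] at hset ⊢
      exact ⟨⟨hset.1.1, hset.1.2, hdisp⟩, fun g hg => hset.2 g ⟨hg.1, hg.2.1⟩⟩
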